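/- **Setting.** Let $M,N\ge 0$ be integers, $a=(a_1,\dots,a_M)$ with all $a_i>0$, and $b=(b_0,b_1,\dots,b_N)$ with all $b_j>0$. Let $f(t)=t^M\prod_{j=1}^M(1-e^{-a_jt})^{-1}$. For $\Re(w)>0$ let $\zeta_M(s,w\,|\,a)$ be the analytic continuation in $s$ to $\mathbb C\setminus\{1,\dots,M\}$ of $$\frac1{\Gamma(s)}\int_0^\infty t^{s-1}e^{-wt}f(t)\,\frac{dt}{t^M},\qquad \Re(s)>M,$$ and let $L_M(w\,|\,a)$ (the Barnes multiple log-gamma function) be the analytic continuation in $w$ to $\mathbb C\setminus(-\infty,0]$ of $\partial_s\zeta_M(s,w\,|\,a)|_{s=0}$, $\Re(w)>0$. For a function $h$ put $$(\mathcal S_Nh)(q\,|\,b)=\sum_{p=0}^N(-1)^p\sum_{1\le k_1<\dots<k_p\le N}h(q+b_0+b_{k_1}+\dots+b_{k_p}),$$ write $(\mathcal S_NL_M)(q\,|\,a,b)$ for $h=L_M(\cdot\,|\,a)$, and let $$\eta_{M,N}(q\,|\,a,b)=\exp\bigl((\mathcal S_NL_M)(q\,|\,a,b)-(\mathcal S_NL_M)(0\,|\,a,b)\bigr),\qquad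 q\in\mathbb C\setminus(-\infty,-b_0].$$ For a number $x$ put $$R_N(x)=\prod_{p=0}^N\Bigl(\prod_{1\le j_1<\dots<j_p\le N}(x+b_{j_1}+\dots+b_{j_p})\Bigr)^{(-1)^p}=\frac{x}{\prod_{j_1}(x+b_{j_1})}\cdot\frac{\prod_{j_1<j_2}(x+b_{j_1}+b_{j_2})}{\prod_{j_1<j_2<j_3}(x+b_{j_1}+b_{j_2}+b_{j_3})}\cdots,$$ whose last factor is $(x+\sum_{j=1}^Nb_j)^{(-1)^N}$. All infinite products below converge unconditionally. **Theorem.** 1. (Action of $\mathcal S_N$ on $L_M$.) If $M<N$, then for all $q\in\mathbb C\setminus(-\infty,-b_0]$, with $\Omega=\sum_{i=1}^Mn_ia_i$, $$\exp\bigl(-(\mathcal S_NL_M)(q\,|\,a,b)\bigr)=\prod_{n_1,\dots,n_M=0}^\infty R_N(q+b_0+\Omega).$$ 2. (The distribution.) If $M\le N$, there is exactly one probability distribution on $(0,1]$, the law of a random variable denoted by $\beta_{M,N}=\beta_{M,N}(a,b)$, such that $\mathbf E[\beta_{M,N}^q]=\eta_{M,N}(q\,|\,a,b)$ for all complex $q$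 with $\Re(q)>-b_0$. 3. (Moments.) If $1\le M\le N$ and $k\ge0$ is an integer, then, with $\Omega=\sum_{i=1}^{M-1}n_ia_i$, $$\mathbf E\bigl[\beta_{M,N}^{k a_M}\bigr]=\prod_{l=0}^{k-1}\ \prod_{n_1,\dots,n_{M-1}=0}^\infty R_N(l\,a_M+b_0+\Omega).$$ 4. (Mass at $1$.) If $M<N$, then, with $\Omega=\sum_{i=1}^Mn_ia_i$, $$\mathbf P[\beta_{M,N}=1]=\prod_{n_1,\dots,n_M=0}^\infty R_N(b_0+\Omega).$$ -/

import Mathlib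

namespace BarnesBeta

/-- The analytic continuation to `U` of a function `f` given on `V ⊆ U` (junk value `f` when there is
no such continuation). For `U` open and connected and `V` open and nonempty there is at most one
continuation, see `analyticContinuation_eqOn`. -/
noncomputable def analyticContinuation (V U : Set ℂ) (f : ℂ → ℂ) : ℂ → ℂ :=
  open Classical in
  if h : ∃ g : ℂ → ℂ, DifferentiableOn ℂ g U ∧ Set.EqOn g f V then h.choose else f

/-- Well-definedness of the analytic continuation. -/
theorem analyticContinuation_eqOn {V U : Set ℂ} {f g : ℂ → ℂ} (hU : IsOpen U)
    (hc : IsPreconnected U) (hV : IsOpen V) (hne : V.Nonempty) (hVU : V ⊆ U)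
    (hg : DifferentiableOn ℂ g U) (hgf : Set.EqOn g f V) :
    Set.EqOn (analyticContinuation V U f) g U := by
  have h : ∃ g : ℂ → ℂ, DifferentiableOn ℂ g U ∧ Set.EqOn g f V := ⟨g, hg, hgf⟩
  have e : analyticContinuation V U f = h.choose := dif_pos h
  rw [e]
  obtain ⟨h1, h2⟩ := h.choose_spec
  obtain ⟨z, hz⟩ := hne
  refine (h1.analyticOnNhd hU).eqOn_of_preconnected_of_eventuallyEq (hg.analyticOnNhd hU) hc
    (hVU hz) ?_
  filter_upwards [hV.mem_nhds hz] with x hx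
  rw [h2 hx, hgf hx]

/-- The function `f(t) = t ^ M * ∏ j, (1 - exp (-a_j t))⁻¹`. -/
noncomputable def barnesF {M : ℕ} (a : Fin M → ℝ) (t : ℝ) : ℝ :=
  t ^ M * ∏ j, (1 - Real.exp (-(a j * t)))⁻¹

/-- `1 / Γ(s) * ∫₀^∞ t ^ (s - 1) * exp (-w t) * f(t) / t ^ M dt`, which converges for `Re s > M` and
`Re w > 0`. -/
noncomputable def zetaIntegral {M : ℕ} (a : Fin M → ℝ) (s w : ℂ) : ℂ :=
  1 / Complex.Gamma s *
    ∫ t in Set.Ioi (0 : ℝ), (t : ℂ) ^ (s - 1) * Complex.exp (-(w * t)) *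
      ((barnesF a t / t ^ M : ℝ) : ℂ)

/-- The Barnes multiple zeta function `ζ_M(s, w | a)` for `Re w > 0`: the continuation in `s` of
`zetaIntegral a s w` from `Re s > M` to `ℂ \ {1, …, M}`. -/
noncomputable def barnesZeta {M : ℕ} (a : Fin M → ℝ) (s w : ℂ) : ℂ :=
  analyticContinuation {s : ℂ | (M : ℝ) < s.re}
    {s : ℂ | ∀ m : ℕ, 1 ≤ m → m ≤ M → s ≠ (m : ℂ)}
    (fun s => zetaIntegral a s w) s

/-- The Barnes multiple log-gamma function `L_M(w | a)`: it is `∂_s ζ_M(s, w | a)` at `s = 0` for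
`Re w > 0`, continued analytically in `w` to `ℂ \ (-∞, 0]`. -/
noncomputable def barnesLogGamma {M : ℕ} (a : Fin M → ℝ) : ℂ → ℂ :=
  analyticContinuation {w : ℂ | 0 < w.re} Complex.slitPlane
    (fun w => deriv (fun s => barnesZeta a s w) 0)

/-- The operator `𝒮_N`:
`(𝒮_N h)(q | b) = ∑_{p=0}^N (-1)^p ∑_{k₁ < ⋯ < k_p} h (q + b₀ + b_{k₁} + ⋯ + b_{k_p})`.
The entry `b_j`, `1 ≤ j ≤ N`, is `b (j - 1)`. -/
noncomputable def opS {N : ℕ} (h : ℂ → ℂ) (q : ℂ) (b₀ : ℝ) (b : Fin N → ℝ) : ℂ :=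
  ∑ p ∈ Finset.range (N + 1), (-1 : ℂ) ^ p *
    ∑ k ∈ Finset.powersetCard p (Finset.univ : Finset (Fin N)),
      h (q + (b₀ : ℂ) + ∑ j ∈ k, (b j : ℂ))

/-- `η_{M,N}(q | a, b) = exp ((𝒮_N L_M)(q | a, b) - (𝒮_N L_M)(0 | a, b))`. -/
noncomputable def barnesEta {M N : ℕ} (a : Fin M → ℝ) (b₀ : ℝ) (b : Fin N → ℝ) (q : ℂ) : ℂ :=
  Complex.exp (opS (barnesLogGamma a) q b₀ b - opS (barnesLogGamma a) 0 b₀ b)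

/-- `μ` is the Barnes beta distribution with parameters `a`, `b`: a probability measure carried by
`(0, 1]` with Mellin transform `η_{M,N}(q | a, b)` for `Re q > -b₀`. -/
structure IsBarnesBeta {M N : ℕ} (a : Fin M → ℝ) (b₀ : ℝ) (b : Fin N → ℝ)
    (μ : MeasureTheory.Measure ℝ) : Prop where
  isProbabilityMeasure : MeasureTheory.IsProbabilityMeasure μ
  support : μ (Set.Ioc (0 : ℝ) 1)ᶜ = 0
  integrable : ∀ q : ℂ, -b₀ < q.re → MeasureTheory.Integrable (fun x : ℝ => (x : ℂ) ^ q) μ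
  mellin : ∀ q : ℂ, -b₀ < q.re → ∫ x : ℝ, (x : ℂ) ^ q ∂μ = barnesEta a b₀ b q

/-- `Ω = ∑ i, n_i a_i`. -/
noncomputable def latticeSum {M : ℕ} (a : Fin M → ℝ) (n : Fin M → ℕ) : ℝ :=
  ∑ i, (n i : ℝ) * a i

/-- The alternating product
`x / ∏_{j₁} (x + b_{j₁}) * ∏_{j₁<j₂} (x + b_{j₁} + b_{j₂}) / ∏_{j₁<j₂<j₃} (⋯) ⋯`, with last factor
`(x + ∑ j, b_j) ^ ((-1) ^ N)`. -/
def altProd {K : Type*} [Field K] {N : ℕ} (x : K) (b : Fin N → K) : K :=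
  ∏ p ∈ Finset.range (N + 1),
    (∏ k ∈ Finset.powersetCard p (Finset.univ : Finset (Fin N)), (x + ∑ j ∈ k, b j)) ^
      ((-1 : ℤ) ^ p)

end BarnesBeta

/-! Everything comes from one integral. Write K(t) = ∏ (1 - exp(-a_i t))⁻¹ for `barnesK`, so that
Γ(s) ζ_M(s, w) is the Mellin transform of exp(-wt) K(t). Applying 𝒮_N replaces exp(-wt) by exp(-(q +
b₀)t) ∏ (1 - exp(-b_j t)), whose zero of order N at t = 0 works against the pole of order M of K.
Since 1/Γ vanishes at 0 with derivative 1, the s-derivative at 0 of a combination whose kernel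
vanishes at t = 0 is the integral of that kernel against dt/t (`sum_deriv_barnesZeta`). Thus, with ν
= `levyDensity` and Re q > -b₀, (𝒮_N L_M)(q) = ∫ exp(-qt) ν(t) dt when M < N, and the increment from
0 to q is ∫ (exp(-qt) - 1) ν(t) dt when M ≤ N.

The second formula is a Lévy–Khintchine representation for X = -log β. If M < N, ν is integrable and
X is compound Poisson. If M = N, ν behaves like C/t at 0; subtracting C exp(-rt)/t with a suitable r
leaves a nonnegative integrable density, and the subtracted part is the Lévy density of a gamma law,
so X is the sum of independent compound Poisson and gamma variables. Uniqueness follows because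
imaginary q give the characteristic function of log β.

For the products, expand K(t) = ∑ exp(-Ωt) inside the integral: (𝒮_N L_M)(q) becomes the lattice sum
of 𝒮_N L_0 at q + Ω, where L_0 = -log, and exponentiating gives R_N. The difference equation L_M(w)
= L_M(w + a_M) + L_{M-1}(w) carries this from a half-plane to the slit plane (`hasSum_opS_log`), and
telescoping it along q = 0, a_M, 2a_M, … gives the moments. The mass at 1 is the limit of E[β^n];
since (𝒮_N L_M)(n) tends to 0, what remains is exp(-(𝒮_N L_M)(0)), already a product.

The continuations must also be shown to exist. In s, finitely many terms of the expansion of K at t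
= 0 are integrated explicitly as Gamma quotients; in w, the same difference equation pushes the
domain to the left by multiples of a_M, by induction on M. -/

namespace BarnesBeta

open Set Filter Topology MeasureTheory Asymptotics

/-! ### Continuation of holomorphic functions -/

/-- A half-plane minus a countable set is connected. -/
theorem isPreconnected_halfPlane_diff (c : ℝ) {P : Set ℂ} (hP : P.Countable) :
    IsPreconnected ({s : ℂ | c < s.re} \ P) := by
  -- The map z ↦ exp(Re z) + c + i Im z is a bijection of the plane onto the half-plane, so the
  -- claim reduces to the complement of a countable set in the whole plane.
  let φ : ℂ → ℂ := fun z => ((Real.exp z.re + c : ℝ) : ℂ) + (z.im : ℂ) * Complex.I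
  have hφ : Continuous φ := by fun_prop
  have hre (z : ℂ) : (φ z).re = Real.exp z.re + c := by simp [φ, Complex.exp_ofReal_re]
  have him (z : ℂ) : (φ z).im = z.im := by simp [φ]
  have hinj : Function.Injective φ := fun z w h => by
    have h1 := congrArg Complex.re h
    have h2 := congrArg Complex.im h
    rw [hre, hre] at h1
    rw [him, him] at h2
    exact Complex.ext (Real.exp_injective (by linarith)) h2
  have himage : φ '' (φ ⁻¹' P)ᶜ = {s : ℂ | c < s.re} \ P := by
    ext s
    constructor
    · rintro ⟨z, hz, rfl⟩
      exact ⟨by rw [mem_ofPred_eq, hre]; linarith [Real.exp_pos z.re], hz⟩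
    · rintro ⟨hs, hsP⟩
      have hs' : 0 < s.re - c := sub_pos.2 hs
      have e : φ ⟨Real.log (s.re - c), s.im⟩ = s :=
        Complex.ext (by rw [hre, Real.exp_log hs']; ring) (by rw [him])
      exact ⟨⟨Real.log (s.re - c), s.im⟩, by rwa [mem_compl_iff, mem_preimage, e], e⟩
  rw [← himage]
  refine IsPreconnected.image ?_ _ hφ.continuousOn
  exact ((hP.preimage hinj).isConnected_compl_of_one_lt_rank
    (by simp [Complex.rank_real_complex])).isPreconnected

/-- Identity theorem on a half-plane minus finitely many points. -/
theorem eqOn_halfPlane_diff {f g : ℂ → ℂ} {c d : ℝ} {P : Set ℂ} (hP : P.Finite)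
    (hPd : ∀ p ∈ P, p.re ≤ d) (hf : DifferentiableOn ℂ f ({s : ℂ | c < s.re} \ P))
    (hg : DifferentiableOn ℂ g ({s : ℂ | c < s.re} \ P)) (h : EqOn f g {s : ℂ | d < s.re}) :
    EqOn f g ({s : ℂ | c < s.re} \ P) := by
  have ho : IsOpen ({s : ℂ | c < s.re} \ P) :=
    (isOpen_lt continuous_const Complex.continuous_re).sdiff hP.isClosed
  have hd : IsOpen {s : ℂ | d < s.re} := isOpen_lt continuous_const Complex.continuous_re
  have hz : ((max c d + 1 : ℝ) : ℂ) ∈ {s : ℂ | d < s.re} := by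
    rw [mem_ofPred_eq, Complex.ofReal_re]; linarith [le_max_right c d]
  refine (hf.analyticOnNhd ho).eqOn_of_preconnected_of_eventuallyEq (hg.analyticOnNhd ho)
    (isPreconnected_halfPlane_diff c hP.countable) (z₀ := ((max c d + 1 : ℝ) : ℂ)) ⟨?_, ?_⟩ ?_
  · rw [mem_ofPred_eq, Complex.ofReal_re]; linarith [le_max_left c d]
  · intro hmem
    have := hPd _ hmem
    rw [Complex.ofReal_re] at this
    linarith [le_max_right c d]
  · filter_upwards [hd.mem_nhds hz] with x hx using h hx

/-- Compatible holomorphic functions on an increasing sequence of open sets glue. -/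
theorem exists_differentiableOn_iUnion {U : ℕ → Set ℂ} {g : ℕ → ℂ → ℂ} (hU : ∀ n, IsOpen (U n))
    (hmono : Monotone U) (hg : ∀ n, DifferentiableOn ℂ (g n) (U n))
    (hcomp : ∀ n, EqOn (g n) (g (n + 1)) (U n)) :
    ∃ G : ℂ → ℂ, DifferentiableOn ℂ G (⋃ n, U n) ∧ ∀ n, EqOn G (g n) (U n) := by
  have key : ∀ m n, m ≤ n → EqOn (g m) (g n) (U m) := by
    intro m n hmn
    induction n, hmn using Nat.le_induction with
    | base => exact fun _ _ => rfl
    | succ n hn ih => exact fun z hz => (ih hz).trans (hcomp n (hmono hn hz))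
  classical
  let G : ℂ → ℂ := fun z => if h : ∃ n, z ∈ U n then g (Nat.find h) z else 0
  have hG : ∀ n, EqOn G (g n) (U n) := by
    intro n z hz
    have h : ∃ n, z ∈ U n := ⟨n, hz⟩
    have e : G z = g (Nat.find h) z := dif_pos h
    rw [e]
    exact key _ _ (Nat.find_min' h hz) (Nat.find_spec h)
  refine ⟨G, ?_, hG⟩
  intro z hz
  obtain ⟨n, hn⟩ := mem_iUnion.1 hz
  have hd : DifferentiableAt ℂ (g n) z := (hg n).differentiableAt ((hU n).mem_nhds hn)
  refine (hd.congr_of_eventuallyEq ?_).differentiableWithinAt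
  filter_upwards [(hU n).mem_nhds hn] with x hx using hG n hx

/-! ### Mellin and Laplace transforms -/

/-- Continuous functions on `(0, ∞)` of size `O (t ^ (-β))` at `0` and of subexponential growth. -/
structure IsSubexp (f : ℝ → ℂ) (β : ℝ) : Prop where
  continuousOn : ContinuousOn f (Ioi 0)
  zero : f =O[𝓝[>] 0] fun t : ℝ => t ^ (-β)
  top : ∀ ε : ℝ, 0 < ε → f =O[atTop] fun t : ℝ => Real.exp (ε * t)

theorem norm_cexp_neg_mul (w : ℂ) (t : ℝ) :
    ‖Complex.exp (-(w * t))‖ = Real.exp (-(w.re * t)) := by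
  rw [Complex.norm_exp]; simp

theorem cexp_isBigO_one (w : ℂ) :
    (fun t : ℝ => Complex.exp (-(w * t))) =O[𝓝[>] 0] fun _ : ℝ => (1 : ℝ) := by
  have : ContinuousAt (fun t : ℝ => Complex.exp (-(w * t))) 0 := by fun_prop
  exact (this.mono_left nhdsWithin_le_nhds).isBigO_one ℝ

namespace IsSubexp

variable {f : ℝ → ℂ} {β : ℝ}

theorem mono {β' : ℝ} (hf : IsSubexp f β) (h : β ≤ β') : IsSubexp f β' := by
  refine ⟨hf.1, hf.2.trans ?_, hf.3⟩
  refine IsBigO.of_bound 1 ?_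
  filter_upwards [Ioo_mem_nhdsGT (zero_lt_one' ℝ)] with t ht
  rw [one_mul, Real.norm_of_nonneg (Real.rpow_nonneg ht.1.le _),
    Real.norm_of_nonneg (Real.rpow_nonneg ht.1.le _)]
  exact Real.rpow_le_rpow_of_exponent_ge ht.1 ht.2.le (by linarith)

/-- Real powers have subexponential growth. -/
theorem rpow (r : ℝ) : IsSubexp (fun t => ((t ^ r : ℝ) : ℂ)) (-r) := by
  refine ⟨?_, ?_, fun ε hε => ?_⟩
  · refine Complex.continuous_ofReal.comp_continuousOn ?_
    exact fun t ht => (Real.continuousAt_rpow_const t r (Or.inl ht.ne')).continuousWithinAt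
  · rw [neg_neg]
    exact IsBigO.of_norm_left (by simpa using (isBigO_refl (fun t : ℝ => t ^ r) _).norm_left)
  · refine IsBigO.of_norm_left ?_
    simpa using (isLittleO_rpow_exp_pos_mul_atTop r hε).isBigO.norm_left

theorem mul_rpow (hf : IsSubexp f β) (r : ℝ) :
    IsSubexp (fun t => f t * ((t ^ r : ℝ) : ℂ)) (β - r) := by
  have hr := rpow r
  refine ⟨hf.1.mul hr.1, (hf.2.mul hr.2).congr' (EventuallyEq.refl _ _) ?_, fun ε hε => ?_⟩
  · filter_upwards [self_mem_nhdsWithin] with t ht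
    rw [← Real.rpow_add ht]
    congr 1
    ring
  · refine ((hf.3 (ε / 2) (half_pos hε)).mul (hr.3 (ε / 2) (half_pos hε))).congr_right fun t => ?_
    rw [← Real.exp_add]
    congr 1
    ring

theorem exp_mul_zero (hf : IsSubexp f β) (w : ℂ) :
    (fun t : ℝ => Complex.exp (-(w * t)) * f t) =O[𝓝[>] 0] fun t : ℝ => t ^ (-β) :=
  ((cexp_isBigO_one w).mul hf.2).congr_right fun _ => one_mul _

theorem exp_mul_top (hf : IsSubexp f β) {w : ℂ} (hw : 0 < w.re) :
    (fun t : ℝ => Complex.exp (-(w * t)) * f t) =O[atTop]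
      fun t : ℝ => Real.exp (-(w.re / 2) * t) := by
  have h1 : (fun t : ℝ => Complex.exp (-(w * t))) =O[atTop]
      fun t : ℝ => Real.exp (-(w.re * t)) :=
    IsBigO.of_norm_left ((isBigO_refl _ _).congr_left fun t => (norm_cexp_neg_mul w t).symm)
  refine (h1.mul (hf.3 (w.re / 2) (half_pos hw))).congr_right fun t => ?_
  rw [← Real.exp_add]
  congr 1
  ring

theorem exp_mul_continuousOn (hf : IsSubexp f β) (w : ℂ) :
    ContinuousOn (fun t : ℝ => Complex.exp (-(w * t)) * f t) (Ioi 0) :=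
  ContinuousOn.mul (by fun_prop) hf.1

end IsSubexp

/-- Continuous functions on `(0, ∞)` of size `O (t ^ (-β))` at `0` and of exponential decay. -/
structure IsExpDecay (f : ℝ → ℂ) (β : ℝ) : Prop where
  continuousOn : ContinuousOn f (Ioi 0)
  zero : f =O[𝓝[>] 0] fun t : ℝ => t ^ (-β)
  top : ∃ ε : ℝ, 0 < ε ∧ f =O[atTop] fun t : ℝ => Real.exp (-ε * t)

namespace IsExpDecay

variable {f : ℝ → ℂ} {β : ℝ}

theorem mellinConvergent (hf : IsExpDecay f β) {s : ℂ} (hs : β < s.re) : MellinConvergent f s := by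
  obtain ⟨ε, hε, h⟩ := hf.top
  exact mellinConvergent_of_isBigO_rpow_exp hε
    (hf.1.locallyIntegrableOn measurableSet_Ioi) h hf.2 hs

theorem differentiableAt_mellin (hf : IsExpDecay f β) {s : ℂ} (hs : β < s.re) :
    DifferentiableAt ℂ (mellin f) s := by
  obtain ⟨ε, hε, h⟩ := hf.top
  exact mellin_differentiableAt_of_isBigO_rpow_exp hε
    (hf.1.locallyIntegrableOn measurableSet_Ioi) h hf.2 hs

theorem sum {ι : Type*} (S : Finset ι) {f : ι → ℝ → ℂ} (hf : ∀ i ∈ S, IsExpDecay (f i) β) :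
    IsExpDecay (fun t => ∑ i ∈ S, f i t) β := by
  classical
  induction S using Finset.induction_on with
  | empty =>
    exact ⟨by simpa using continuousOn_const, by simpa using isBigO_zero _ _,
      1, one_pos, by simpa using isBigO_zero _ _⟩
  | insert i S hi ih =>
    have h1 := hf i (Finset.mem_insert_self i S)
    have h2 := ih fun j hj => hf j (Finset.mem_insert_of_mem hj)
    simp only [Finset.sum_insert hi]
    obtain ⟨ε₁, hε₁, ht₁⟩ := h1.top
    obtain ⟨ε₂, hε₂, ht₂⟩ := h2.top
    have hexp : ∀ {a b : ℝ}, a ≤ b →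
        (fun t : ℝ => Real.exp (-b * t)) =O[atTop] fun t : ℝ => Real.exp (-a * t) := by
      intro a b hab
      refine IsBigO.of_bound 1 ?_
      filter_upwards [eventually_ge_atTop 0] with t ht
      rw [one_mul, Real.norm_of_nonneg (Real.exp_nonneg _),
        Real.norm_of_nonneg (Real.exp_nonneg _)]
      exact Real.exp_le_exp.2 (by nlinarith)
    exact ⟨h1.1.add h2.1, h1.2.add h2.2, min ε₁ ε₂, lt_min hε₁ hε₂,
      (ht₁.trans (hexp (min_le_left _ _))).add (ht₂.trans (hexp (min_le_right _ _)))⟩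

theorem const_mul (hf : IsExpDecay f β) (c : ℂ) : IsExpDecay (fun t => c * f t) β := by
  obtain ⟨ε, hε, h⟩ := hf.top
  exact ⟨continuousOn_const.mul hf.1, hf.2.const_mul_left c, ε, hε, h.const_mul_left c⟩

theorem integrableOn (hf : IsExpDecay f β) (hβ : β < 1) : IntegrableOn f (Ioi 0) := by
  have h := hf.mellinConvergent (s := 1) (by simpa using hβ)
  simpa [MellinConvergent] using h

end IsExpDecay

theorem IsSubexp.exp_mul {f : ℝ → ℂ} {β : ℝ} (hf : IsSubexp f β) {w : ℂ} (hw : 0 < w.re) :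
    IsExpDecay (fun t : ℝ => Complex.exp (-(w * t)) * f t) β :=
  ⟨hf.exp_mul_continuousOn w, hf.exp_mul_zero w, w.re / 2, half_pos hw, hf.exp_mul_top hw⟩

/-- The Laplace transform of a function of subexponential growth is holomorphic on the right
half-plane. -/
theorem IsSubexp.differentiableOn_laplace {f : ℝ → ℂ} {β : ℝ} (hf : IsSubexp f β) (hβ : β < 1) :
    DifferentiableOn ℂ (fun w : ℂ => ∫ t in Ioi (0 : ℝ), Complex.exp (-(w * t)) * f t)
      {w : ℂ | 0 < w.re} := by
  intro w hw
  have hw' : 0 < w.re / 2 := half_pos hw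
  -- Differentiating in w produces a factor t, which only improves the behaviour at 0. On the
  -- half-plane Re z > Re w / 2 the derivative is dominated by the integrand at the real point Re w
  -- / 2.
  have hf1 : IsSubexp (fun t => f t * ((t ^ (1 : ℝ) : ℝ) : ℂ)) (β - 1) := hf.mul_rpow 1
  have hs : {z : ℂ | w.re / 2 < z.re} ∈ 𝓝 w :=
    (isOpen_lt continuous_const Complex.continuous_re).mem_nhds
      (by rw [mem_ofPred_eq]; linarith [show 0 < w.re from hw])
  have hbound := ((hf1.exp_mul (w := ((w.re / 2 : ℝ) : ℂ)) (by simpa using hw')).integrableOn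
    (by linarith)).norm
  have hmeas : ∀ (z : ℂ), AEStronglyMeasurable (fun t : ℝ => Complex.exp (-(z * t)) * f t)
      (volume.restrict (Ioi 0)) := fun z =>
    (hf.exp_mul_continuousOn z).aestronglyMeasurable measurableSet_Ioi
  have key := hasDerivAt_integral_of_dominated_loc_of_deriv_le (μ := volume.restrict (Ioi (0 : ℝ)))
    (F := fun (z : ℂ) (t : ℝ) => Complex.exp (-(z * t)) * f t)
    (F' := fun (z : ℂ) (t : ℝ) => Complex.exp (-(z * t)) * (-t) * f t) (x₀ := w) hs
    (Eventually.of_forall hmeas)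
    ((hf.exp_mul hw).integrableOn hβ)
    (ContinuousOn.aestronglyMeasurable (ContinuousOn.mul (by fun_prop) hf.1) measurableSet_Ioi)
    (bound := fun t : ℝ => ‖Complex.exp (-(((w.re / 2 : ℝ) : ℂ) * t)) *
      (f t * ((t ^ (1 : ℝ) : ℝ) : ℂ))‖) ?_ hbound ?_
  · exact key.2.differentiableAt.differentiableWithinAt
  · refine (ae_restrict_iff' measurableSet_Ioi).2 (Eventually.of_forall fun t ht z hz => ?_)
    have ht' : 0 < t := ht
    have hz' : w.re / 2 < z.re := hz
    rw [Real.rpow_one, norm_mul, norm_mul, norm_mul, norm_mul, norm_cexp_neg_mul,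
      norm_cexp_neg_mul, norm_neg, mul_assoc, mul_comm ‖(t : ℂ)‖, Complex.ofReal_re]
    gcongr
  · refine Eventually.of_forall fun t z _ => ?_
    have h : HasDerivAt (fun z : ℂ => -(z * (t : ℂ))) (-t) z := by
      simpa using ((hasDerivAt_id z).mul_const (t : ℂ)).fun_neg
    exact h.cexp.mul_const _

/-- The Gamma integral with a complex rate. -/
theorem integral_cpow_mul_cexp_neg_mul {s w : ℂ} (hs : 0 < s.re) (hw : 0 < w.re) :
    ∫ t in Ioi (0 : ℝ), (t : ℂ) ^ (s - 1) * Complex.exp (-(w * t)) =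
      Complex.Gamma s * w ^ (-s) := by
  have hsub : IsSubexp (fun t : ℝ => (t : ℂ) ^ (s - 1)) (-(s.re - 1)) := by
    have h := IsSubexp.rpow (s.re - 1)
    have hn : ∀ t : ℝ, 0 < t → ‖(t : ℂ) ^ (s - 1)‖ = ‖((t ^ (s.re - 1) : ℝ) : ℂ)‖ := by
      intro t ht
      rw [Complex.norm_cpow_eq_rpow_re_of_pos ht, Complex.norm_real,
        Real.norm_of_nonneg (Real.rpow_nonneg ht.le _)]
      simp
    refine ⟨?_, ?_, fun ε hε => ?_⟩
    · intro t ht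
      exact (Complex.continuousAt_ofReal_cpow_const t _ (Or.inr (ne_of_gt ht))).continuousWithinAt
    · refine IsBigO.of_norm_left (h.2.norm_left.congr' ?_ (EventuallyEq.refl _ _))
      filter_upwards [self_mem_nhdsWithin] with t ht using (hn t ht).symm
    · refine IsBigO.of_norm_left ((h.3 ε hε).norm_left.congr' ?_ (EventuallyEq.refl _ _))
      filter_upwards [eventually_gt_atTop 0] with t ht using (hn t ht).symm
  have hU : IsOpen {w : ℂ | 0 < w.re} := isOpen_lt continuous_const Complex.continuous_re
  have hleft : DifferentiableOn ℂ (fun w : ℂ => ∫ t in Ioi (0 : ℝ), Complex.exp (-(w * t)) *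
      (t : ℂ) ^ (s - 1)) {w : ℂ | 0 < w.re} := hsub.differentiableOn_laplace (by linarith)
  have hright : DifferentiableOn ℂ (fun w : ℂ => Complex.Gamma s * w ^ (-s))
      {w : ℂ | 0 < w.re} := fun w hw =>
    ((differentiableAt_id.cpow_const (Or.inl hw)).const_mul _).differentiableWithinAt
  have hconn : IsPreconnected {w : ℂ | 0 < w.re} :=
    (convex_halfSpace_re_gt 0).isPreconnected
  -- For positive real rates this is the classical Gamma integral; such rates accumulate at 1, so
  -- the identity theorem gives all rates in the half-plane.
  have hfreq : ∃ᶠ z in 𝓝[≠] (1 : ℂ), (∫ t in Ioi (0 : ℝ), Complex.exp (-(z * t)) *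
      (t : ℂ) ^ (s - 1)) = Complex.Gamma s * z ^ (-s) := by
    have hreal : ∀ r : ℝ, 0 < r → (∫ t in Ioi (0 : ℝ), Complex.exp (-((r : ℂ) * t)) *
        (t : ℂ) ^ (s - 1)) = Complex.Gamma s * (r : ℂ) ^ (-s) := by
      intro r hr
      have h := Complex.integral_cpow_mul_exp_neg_mul_Ioi hs hr
      simp only [mul_comm (Complex.exp _)]
      rw [h, mul_comm, one_div, Complex.inv_cpow, Complex.cpow_neg]
      rw [Complex.arg_ofReal_of_nonneg hr.le]
      exact Real.pi_pos.ne
    have htend : Tendsto (fun r : ℝ => (r : ℂ)) (𝓝[≠] 1) (𝓝[≠] (1 : ℂ)) := by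
      refine tendsto_nhdsWithin_iff.2 ⟨?_, ?_⟩
      · have : ContinuousAt (fun r : ℝ => (r : ℂ)) 1 := by fun_prop
        simpa using (this.tendsto.mono_left nhdsWithin_le_nhds)
      · filter_upwards [self_mem_nhdsWithin] with r hr
        simpa using hr
    refine htend.frequently (Eventually.frequently ?_)
    filter_upwards [nhdsWithin_le_nhds (Ioi_mem_nhds (zero_lt_one' ℝ))] with r hr
    exact hreal r hr
  have := (hleft.analyticOnNhd hU).eqOn_of_preconnected_of_frequently_eq
    (hright.analyticOnNhd hU) hconn (z₀ := 1) (by simp) hfreq hw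
  simpa only [mul_comm (Complex.exp _)] using this

/-! ### The kernel of the Barnes zeta function -/

/-- The kernel `∏ j, (1 - exp (-a_j t))⁻¹`. -/
noncomputable def barnesK {M : ℕ} (a : Fin M → ℝ) (t : ℝ) : ℝ :=
  ∏ j, (1 - Real.exp (-(a j * t)))⁻¹

/-- The continuous extension of `(1 - exp (-b t)) / t` to `t = 0`. -/
noncomputable def expQuot (b : ℝ) : ℝ → ℝ := dslope (fun t => 1 - Real.exp (-(b * t))) 0

theorem expQuot_of_ne {b t : ℝ} (ht : t ≠ 0) : expQuot b t = (1 - Real.exp (-(b * t))) / t := by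
  simp [expQuot, dslope_of_ne _ ht, slope_def_field]

theorem expQuot_zero (b : ℝ) : expQuot b 0 = b := by
  have h : HasDerivAt (fun t : ℝ => 1 - Real.exp (-(b * t))) b 0 := by
    have h1 : HasDerivAt (fun t : ℝ => -(b * t)) (-b) 0 := by
      simpa using ((hasDerivAt_id (0 : ℝ)).const_mul b).fun_neg
    simpa using h1.exp.const_sub 1
  rw [expQuot, dslope_same, h.deriv]

/-- Dividing 1 - exp(-bt) by t shifts its power series by one index. -/
theorem analyticAt_expQuot (b : ℝ) : AnalyticAt ℝ (expQuot b) 0 := by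
  have h : AnalyticAt ℝ (fun t : ℝ => 1 - Real.exp (-(b * t))) 0 := by fun_prop
  obtain ⟨p, hp⟩ := h
  exact ⟨_, hp.has_fpower_series_dslope_fslope⟩

theorem one_sub_exp_pos {b t : ℝ} (hb : 0 < b) (ht : 0 < t) : 0 < 1 - Real.exp (-(b * t)) := by
  rw [sub_pos, Real.exp_lt_one_iff]
  exact neg_neg_of_pos (mul_pos hb ht)

theorem barnesK_pos {M : ℕ} {a : Fin M → ℝ} (ha : ∀ i, 0 < a i) {t : ℝ} (ht : 0 < t) :
    0 < barnesK a t :=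
  Finset.prod_pos fun j _ => inv_pos.2 (one_sub_exp_pos (ha j) ht)

theorem barnesK_eq {M : ℕ} (a : Fin M → ℝ) {t : ℝ} (ht : 0 < t) :
    barnesK a t = barnesF a t / t ^ M := by
  rw [barnesF, mul_div_cancel_left₀ _ (pow_pos ht M).ne', barnesK]

/-- This isolates the pole of order M; the remaining factor is analytic at 0 because `expQuot (a j)
0 = a j` is nonzero. -/
theorem barnesK_eq_expQuot {M : ℕ} (a : Fin M → ℝ) {t : ℝ} (ht : 0 < t) :
    barnesK a t = (∏ j, (expQuot (a j) t)⁻¹) * t ^ (-(M : ℝ)) := by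
  have : t ^ (-(M : ℝ)) = ∏ _j : Fin M, t⁻¹ := by
    rw [Real.rpow_neg ht.le, Real.rpow_natCast]; simp
  rw [this, ← Finset.prod_mul_distrib, barnesK]
  refine Finset.prod_congr rfl fun j _ => ?_
  rw [expQuot_of_ne ht.ne', ← mul_inv, div_mul_cancel₀ _ ht.ne']

theorem barnesK_succ {M : ℕ} (a : Fin (M + 1) → ℝ) (t : ℝ) :
    barnesK a t =
      barnesK (fun i : Fin M => a i.castSucc) t * (1 - Real.exp (-(a (Fin.last M) * t)))⁻¹ := by
  rw [barnesK, Fin.prod_univ_castSucc, barnesK]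

theorem continuousOn_barnesK {M : ℕ} {a : Fin M → ℝ} (ha : ∀ i, 0 < a i) :
    ContinuousOn (barnesK a) (Ioi 0) := by
  refine continuousOn_finsetProd _ fun j _ => ContinuousOn.inv₀ (by fun_prop) fun t ht => ?_
  exact (one_sub_exp_pos (ha j) ht).ne'

theorem barnesK_isBigO_exp {M : ℕ} {a : Fin M → ℝ} (ha : ∀ i, 0 < a i) {ε : ℝ} (hε : 0 < ε) :
    (fun t => (barnesK a t : ℂ)) =O[atTop] fun t : ℝ => Real.exp (ε * t) := by
  have h : Tendsto (barnesK a) atTop (𝓝 (∏ _j : Fin M, (1 - 0 : ℝ)⁻¹)) := by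
    refine tendsto_finsetProd _ fun j _ => Tendsto.inv₀ (tendsto_const_nhds.sub ?_) (by simp)
    refine Real.tendsto_exp_atBot.comp ?_
    exact tendsto_neg_atTop_atBot.comp (tendsto_id.const_mul_atTop (ha j))
  have h1 : (fun t => (barnesK a t : ℂ)) =O[atTop] fun _ : ℝ => (1 : ℝ) := by
    refine IsBigO.of_norm_left ?_
    simpa using (h.isBigO_one ℝ).norm_left
  refine h1.trans (IsBigO.of_bound 1 ?_)
  filter_upwards [eventually_ge_atTop 0] with t ht
  rw [norm_one, one_mul, Real.norm_of_nonneg (Real.exp_nonneg _)]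
  exact Real.one_le_exp (by positivity)

/-- The kernel has an asymptotic expansion in powers of `t` at `0`. -/
theorem exists_barnesK_expansion {M : ℕ} {a : Fin M → ℝ} (ha : ∀ i, 0 < a i) :
    ∃ c : ℕ → ℂ, ∀ n : ℕ, IsSubexp (fun t => (barnesK a t : ℂ) -
      ∑ k ∈ Finset.range n, c k * ((t ^ ((k : ℝ) - M) : ℝ) : ℂ)) (M - n) := by
  have hA : AnalyticAt ℝ (fun t => ∏ j, (expQuot (a j) t)⁻¹) 0 :=
    Finset.analyticAt_fun_prod _ fun j _ =>
      (analyticAt_expQuot (a j)).inv (by rw [expQuot_zero]; exact (ha j).ne')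
  obtain ⟨p, hp⟩ := hA
  refine ⟨fun k => (p.coeff k : ℂ), fun n => ⟨?_, ?_, fun ε hε => ?_⟩⟩
  · refine (Complex.continuous_ofReal.comp_continuousOn (continuousOn_barnesK ha)).sub ?_
    exact continuousOn_finsetSum _ fun k _ => continuousOn_const.mul (IsSubexp.rpow _).1
  · have h := (hp.isBigO_sub_partialSum_pow n).mono (nhdsWithin_le_nhds (s := Ioi 0))
    simp only [zero_add] at h
    have h2 := h.mul (isBigO_refl (fun t : ℝ => t ^ (-(M : ℝ))) (𝓝[>] 0))
    refine IsBigO.of_norm_left (h2.norm_left.congr' ?_ ?_)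
    · filter_upwards [self_mem_nhdsWithin] with t ht
      have ht' : 0 < t := ht
      rw [← Complex.norm_real]
      congr 1
      rw [sub_mul, ← barnesK_eq_expQuot a ht', FormalMultilinearSeries.partialSum, Finset.sum_mul]
      push_cast
      congr 1
      refine Finset.sum_congr rfl fun k _ => ?_
      rw [FormalMultilinearSeries.apply_eq_pow_smul_coeff, Real.rpow_sub ht', Real.rpow_natCast,
        Real.rpow_neg ht'.le]
      push_cast
      simp only [smul_eq_mul]
      push_cast
      ring
    · filter_upwards [self_mem_nhdsWithin] with t ht
      have ht' : 0 < t := ht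
      rw [Real.norm_of_nonneg ht'.le, ← Real.rpow_natCast, ← Real.rpow_add ht']
      congr 1
      ring
  · exact (barnesK_isBigO_exp ha hε).sub
      (IsBigO.fun_sum fun k _ => ((IsSubexp.rpow _).3 ε hε).const_mul_left _)

theorem isSubexp_barnesK {M : ℕ} {a : Fin M → ℝ} (ha : ∀ i, 0 < a i) :
    IsSubexp (fun t => (barnesK a t : ℂ)) M := by
  obtain ⟨c, hc⟩ := exists_barnesK_expansion ha
  simpa using hc 0

/-! ### Continuation of the Barnes zeta function in `s` -/

/-- The poles `1, …, M`. -/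
def barnesPoles (M : ℕ) : Set ℂ := {s | ∃ m : ℕ, 1 ≤ m ∧ m ≤ M ∧ s = m}

theorem finite_barnesPoles (M : ℕ) : (barnesPoles M).Finite := by
  refine ((Set.finite_Icc 1 M).image (fun m : ℕ => (m : ℂ))).subset ?_
  rintro s ⟨m, h1, h2, rfl⟩
  exact ⟨m, ⟨h1, h2⟩, rfl⟩

theorem re_le_of_mem_barnesPoles {M : ℕ} {s : ℂ} (hs : s ∈ barnesPoles M) : s.re ≤ M := by
  obtain ⟨m, -, h2, rfl⟩ := hs
  simpa using h2

theorem barnesPoles_mono {M N : ℕ} (h : M ≤ N) : barnesPoles M ⊆ barnesPoles N := by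
  rintro s ⟨m, h1, h2, rfl⟩
  exact ⟨m, h1, h2.trans h, rfl⟩

theorem zero_notMem_barnesPoles (M : ℕ) : (0 : ℂ) ∉ barnesPoles M := by
  rintro ⟨m, h1, -, h⟩
  have : m = 0 := by exact_mod_cast h.symm
  omega

theorem setOf_ne_eq_compl_barnesPoles (M : ℕ) :
    {s : ℂ | ∀ m : ℕ, 1 ≤ m → m ≤ M → s ≠ (m : ℂ)} = (barnesPoles M)ᶜ := by
  ext s
  simp [barnesPoles]

/-- The product `∏_{i < k} (s - M + i)`. -/
noncomputable def shiftProd (M k : ℕ) (s : ℂ) : ℂ := ∏ i ∈ Finset.range k, (s - M + i)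

/-- The zeros of this product are M - i for i < M, which are the excluded points 1, …, M. -/
theorem shiftProd_self_ne_zero {M : ℕ} {s : ℂ} (hs : s ∉ barnesPoles M) : shiftProd M M s ≠ 0 := by
  refine Finset.prod_ne_zero_iff.2 fun i hi h => hs ⟨M - i, ?_, Nat.sub_le _ _, ?_⟩
  · have := Finset.mem_range.1 hi; omega
  · rw [Nat.cast_sub (Finset.mem_range.1 hi).le]
    linear_combination h

theorem differentiable_shiftProd (M k : ℕ) : Differentiable ℂ (shiftProd M k) := by
  unfold shiftProd
  fun_prop

theorem Gamma_add_nat {z : ℂ} (hz : 0 < z.re) (n : ℕ) :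
    Complex.Gamma (z + n) = (∏ i ∈ Finset.range n, (z + i)) * Complex.Gamma z := by
  induction n with
  | zero => simp
  | succ n ih =>
    have hne : z + n ≠ 0 := fun h => by
      have := congrArg Complex.re h
      simp at this
      linarith [(Nat.cast_nonneg n : (0 : ℝ) ≤ n)]
    rw [Finset.prod_range_succ, Nat.cast_succ, ← add_assoc, Complex.Gamma_add_one _ hne, ih]
    ring

theorem zetaIntegral_eq {M : ℕ} (a : Fin M → ℝ) (s w : ℂ) :
    zetaIntegral a s w = (Complex.Gamma s)⁻¹ *
      mellin (fun t : ℝ => Complex.exp (-(w * t)) * (barnesK a t : ℂ)) s := by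
  rw [zetaIntegral, mellin, one_div]
  congr 1
  refine setIntegral_congr_fun measurableSet_Ioi fun t ht => ?_
  simp only [smul_eq_mul]
  rw [barnesK_eq a ht, mul_assoc]

/-- This evaluates the contribution of a single term of the expansion of the kernel. -/
theorem mellin_exp_mul_rpow {s w : ℂ} (hw : 0 < w.re) {r : ℝ} (hs : 0 < s.re + r) :
    mellin (fun t : ℝ => Complex.exp (-(w * t)) * ((t ^ r : ℝ) : ℂ)) s =
      Complex.Gamma (s + r) * w ^ (-(s + r)) := by
  rw [← integral_cpow_mul_cexp_neg_mul (by simpa using hs) hw, mellin]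
  refine setIntegral_congr_fun measurableSet_Ioi fun t ht => ?_
  have ht' : 0 < t := ht
  simp only [smul_eq_mul]
  rw [Complex.ofReal_cpow ht'.le, show s + r - 1 = (s - 1) + r by ring,
    Complex.cpow_add _ _ (Complex.ofReal_ne_zero.2 ht'.ne')]
  ring

/-- The continuation of `zetaIntegral` to `Re s > M - n`, in terms of the first `n` coefficients `c`
of the asymptotic expansion of the kernel. -/
noncomputable def zetaCont {M : ℕ} (a : Fin M → ℝ) (c : ℕ → ℂ) (n : ℕ) (s w : ℂ) : ℂ :=
  (∑ k ∈ Finset.range n, c k * (shiftProd M k s / shiftProd M M s * w ^ ((M : ℂ) - k - s))) +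
    (Complex.Gamma s)⁻¹ * mellin (fun t : ℝ => Complex.exp (-(w * t)) * ((barnesK a t : ℂ) -
      ∑ k ∈ Finset.range n, c k * ((t ^ ((k : ℝ) - M) : ℝ) : ℂ))) s

section Continuation

variable {M : ℕ} {a : Fin M → ℝ} {c : ℕ → ℂ} {w : ℂ}

theorem differentiableOn_zetaCont (hc : ∀ n : ℕ, IsSubexp (fun t => (barnesK a t : ℂ) -
      ∑ k ∈ Finset.range n, c k * ((t ^ ((k : ℝ) - M) : ℝ) : ℂ)) (M - n)) (hw : 0 < w.re) (n : ℕ) :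
    DifferentiableOn ℂ (fun s => zetaCont a c n s w)
      ({s : ℂ | (M : ℝ) - n < s.re} \ barnesPoles M) := by
  intro s hs
  have hw0 : w ≠ 0 := fun h => by simp [h] at hw
  refine DifferentiableAt.differentiableWithinAt (DifferentiableAt.add ?_ ?_)
  · refine DifferentiableAt.fun_sum fun k _ => DifferentiableAt.const_mul (DifferentiableAt.mul
      ((differentiable_shiftProd M k s).div (differentiable_shiftProd M M s)
        (shiftProd_self_ne_zero hs.2)) ?_) _
    exact DifferentiableAt.const_cpow (by fun_prop) (Or.inl hw0)
  · exact (Complex.differentiable_one_div_Gamma s).mul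
      (((hc n).exp_mul hw).differentiableAt_mellin hs.1)

/-- The k-th term integrates to Γ(s - M + k) w^(M-k-s). Both Γ(s - M + k) and Γ(s) are polynomial
multiples of Γ(s - M), so their quotient is a rational function with poles only in 1, …, M, and it
makes sense beyond the half-plane of convergence. -/
theorem zetaIntegral_eq_zetaCont (hc : ∀ n : ℕ, IsSubexp (fun t => (barnesK a t : ℂ) -
      ∑ k ∈ Finset.range n, c k * ((t ^ ((k : ℝ) - M) : ℝ) : ℂ)) (M - n)) (hw : 0 < w.re) (n : ℕ)
    {s : ℂ} (hs : (M : ℝ) < s.re) : zetaIntegral a s w = zetaCont a c n s w := by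
  have hsn : (M : ℝ) - n < s.re := by linarith [(Nat.cast_nonneg n : (0 : ℝ) ≤ n)]
  have hz : 0 < (s - M).re := by simpa using hs
  have hterm : ∀ k : ℕ, IsExpDecay (fun t : ℝ => Complex.exp (-(w * t)) *
      ((t ^ ((k : ℝ) - M) : ℝ) : ℂ)) M := fun k =>
    ((IsSubexp.rpow _).mono (by linarith [(Nat.cast_nonneg k : (0 : ℝ) ≤ k)])).exp_mul hw
  have hsum : IsExpDecay (fun t : ℝ => ∑ k ∈ Finset.range n, c k * (Complex.exp (-(w * t)) *
      ((t ^ ((k : ℝ) - M) : ℝ) : ℂ))) M := IsExpDecay.sum _ fun k _ => (hterm k).const_mul _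
  have hadd := hasMellin_add (hsum.mellinConvergent hs)
    (((hc n).exp_mul hw).mellinConvergent hsn)
  have e1 : (fun t : ℝ => Complex.exp (-(w * t)) * (barnesK a t : ℂ)) = fun t : ℝ =>
      (∑ k ∈ Finset.range n, c k * (Complex.exp (-(w * t)) * ((t ^ ((k : ℝ) - M) : ℝ) : ℂ))) +
      Complex.exp (-(w * t)) * ((barnesK a t : ℂ) -
        ∑ k ∈ Finset.range n, c k * ((t ^ ((k : ℝ) - M) : ℝ) : ℂ)) := by
    funext t
    rw [mul_sub, Finset.mul_sum]
    simp only [mul_left_comm (c _)]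
    ring
  have e2 : mellin (fun t : ℝ => ∑ k ∈ Finset.range n, c k * (Complex.exp (-(w * t)) *
      ((t ^ ((k : ℝ) - M) : ℝ) : ℂ))) s =
      ∑ k ∈ Finset.range n, c k * (Complex.Gamma (s + ((k : ℝ) - M : ℝ)) *
        w ^ (-(s + ((k : ℝ) - M : ℝ)))) := by
    have e3 : ∀ k ∈ Finset.range n, c k * (Complex.Gamma (s + ((k : ℝ) - M : ℝ)) *
        w ^ (-(s + ((k : ℝ) - M : ℝ)))) = ∫ t in Ioi (0 : ℝ), (t : ℂ) ^ (s - 1) •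
          (c k * (Complex.exp (-(w * t)) * ((t ^ ((k : ℝ) - M) : ℝ) : ℂ))) := by
      intro k _
      rw [← mellin_exp_mul_rpow hw (by linarith [(Nat.cast_nonneg k : (0 : ℝ) ≤ k)]), mellin,
        ← integral_const_mul]
      simp only [smul_eq_mul, mul_left_comm (c k)]
    rw [Finset.sum_congr rfl e3, ← integral_finsetSum]
    · simp only [mellin, Finset.smul_sum]
    · exact fun k _ => ((hterm k).const_mul (c k)).mellinConvergent hs
  rw [zetaIntegral_eq, e1, hadd.2, e2, mul_add, zetaCont, Finset.mul_sum]
  congr 1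
  refine Finset.sum_congr rfl fun k _ => ?_
  have hG : Complex.Gamma s = shiftProd M M s * Complex.Gamma (s - M) := by
    rw [shiftProd, ← Gamma_add_nat hz, sub_add_cancel]
  have hGk : Complex.Gamma (s + ((k : ℝ) - M : ℝ)) = shiftProd M k s * Complex.Gamma (s - M) := by
    rw [shiftProd, ← Gamma_add_nat hz]
    congr 1
    push_cast
    ring
  have hG0 : Complex.Gamma (s - M) ≠ 0 := Complex.Gamma_ne_zero_of_re_pos hz
  have hQ0 : shiftProd M M s ≠ 0 :=
    shiftProd_self_ne_zero fun h => absurd (re_le_of_mem_barnesPoles h) (not_le.2 hs)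
  have hexp : -(s + (((k : ℝ) - M : ℝ) : ℂ)) = (M : ℂ) - k - s := by push_cast; ring
  rw [hGk, hG, hexp]
  field_simp

/-- Subtracting n terms of the expansion gives a continuation to Re s > M - n. These agree on
overlaps by the identity theorem, and the half-planes exhaust ℂ. -/
theorem exists_zeta_continuation (ha : ∀ i, 0 < a i) (hw : 0 < w.re) :
    ∃ g : ℂ → ℂ, DifferentiableOn ℂ g (barnesPoles M)ᶜ ∧
      EqOn g (fun s => zetaIntegral a s w) {s : ℂ | (M : ℝ) < s.re} := by
  obtain ⟨c, hc⟩ := exists_barnesK_expansion ha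
  have hd := differentiableOn_zetaCont hc hw
  obtain ⟨G, hG, hGn⟩ := exists_differentiableOn_iUnion
    (U := fun n : ℕ => {s : ℂ | (M : ℝ) - n < s.re} \ barnesPoles M)
    (g := fun n s => zetaCont a c n s w)
    (fun n => (isOpen_lt continuous_const Complex.continuous_re).sdiff
      (finite_barnesPoles M).isClosed)
    (fun m n hmn s hs => ⟨by
      have h1 : (M : ℝ) - m < s.re := hs.1
      have h2 : (m : ℝ) ≤ n := by exact_mod_cast hmn
      show (M : ℝ) - n < s.re
      linarith, hs.2⟩) hd
    (fun n => by
      refine eqOn_halfPlane_diff (d := M) (finite_barnesPoles M)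
        (fun p hp => re_le_of_mem_barnesPoles hp) (hd n) ((hd (n + 1)).mono ?_) fun s hs => ?_
      · intro s hs
        refine ⟨?_, hs.2⟩
        have h1 : (M : ℝ) - n < s.re := hs.1
        show (M : ℝ) - ((n + 1 : ℕ) : ℝ) < s.re
        push_cast
        linarith
      · rw [← zetaIntegral_eq_zetaCont hc hw n hs, ← zetaIntegral_eq_zetaCont hc hw (n + 1) hs])
  refine ⟨G, hG.mono fun s hs => ?_, fun s hs => ?_⟩
  · obtain ⟨n, hn⟩ := exists_nat_gt ((M : ℝ) - s.re)
    exact mem_iUnion.2 ⟨n, by show (M : ℝ) - n < s.re; linarith, hs⟩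
  · rw [hGn 0 ⟨by simpa using hs, fun h => absurd (re_le_of_mem_barnesPoles h) (not_le.2 hs)⟩]
    exact (zetaIntegral_eq_zetaCont hc hw 0 hs).symm

theorem barnesZeta_spec (ha : ∀ i, 0 < a i) (hw : 0 < w.re) :
    DifferentiableOn ℂ (fun s => barnesZeta a s w) (barnesPoles M)ᶜ ∧
      ∀ s : ℂ, (M : ℝ) < s.re → barnesZeta a s w = zetaIntegral a s w := by
  obtain ⟨g, hg, hgz⟩ := exists_zeta_continuation ha hw
  have hsub : {s : ℂ | (M : ℝ) < s.re} ⊆ (barnesPoles M)ᶜ := fun s hs h =>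
    absurd (re_le_of_mem_barnesPoles h) (not_le.2 hs)
  have h : EqOn (fun s => barnesZeta a s w) g (barnesPoles M)ᶜ := by
    have := analyticContinuation_eqOn (finite_barnesPoles M).isClosed.isOpen_compl
      ((finite_barnesPoles M).countable.isConnected_compl_of_one_lt_rank
        (by simp [Complex.rank_real_complex])).isPreconnected
      (isOpen_lt continuous_const Complex.continuous_re) ⟨((M + 1 : ℝ) : ℂ), by
        rw [mem_ofPred_eq, Complex.ofReal_re]; linarith⟩ hsub hg hgz
    intro s hs
    simp only [barnesZeta, setOf_ne_eq_compl_barnesPoles]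
    exact this hs
  exact ⟨hg.congr h, fun s hs => (h (hsub hs)).trans (hgz hs)⟩

theorem compl_barnesPoles_mem_nhds_zero (M : ℕ) : (barnesPoles M)ᶜ ∈ 𝓝 (0 : ℂ) :=
  (finite_barnesPoles M).isClosed.isOpen_compl.mem_nhds (zero_notMem_barnesPoles M)

theorem differentiableAt_barnesZeta_zero (ha : ∀ i, 0 < a i) (hw : 0 < w.re) :
    DifferentiableAt ℂ (fun s => barnesZeta a s w) 0 :=
  (barnesZeta_spec ha hw).1.differentiableAt (compl_barnesPoles_mem_nhds_zero M)

/-! ### The derivative at `s = 0` -/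

/-- Since 1/Γ(s) = s/Γ(s + 1), the reciprocal Gamma function has value 0 and derivative 1 at 0. -/
theorem hasDerivAt_inv_Gamma_mul {m : ℂ → ℂ} (hm : DifferentiableAt ℂ m 0) :
    HasDerivAt (fun s => (Complex.Gamma s)⁻¹ * m s) (m 0) 0 := by
  have h1 : HasDerivAt (fun s : ℂ => (Complex.Gamma s)⁻¹) 1 0 := by
    have e : (fun s : ℂ => (Complex.Gamma s)⁻¹) = fun s => s * (Complex.Gamma (s + 1))⁻¹ :=
      funext Complex.one_div_Gamma_eq_self_mul_one_div_Gamma_add_one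
    have hd : DifferentiableAt ℂ (fun s : ℂ => (Complex.Gamma (s + 1))⁻¹) 0 :=
      (Complex.differentiable_one_div_Gamma.comp (differentiable_id.add_const (1 : ℂ))) 0
    rw [e]
    simpa using (hasDerivAt_id (0 : ℂ)).fun_mul hd.hasDerivAt
  simpa using h1.fun_mul hm.hasDerivAt

theorem mellin_zero_eq (f : ℝ → ℂ) : mellin f 0 = ∫ t in Ioi (0 : ℝ), ((t⁻¹ : ℝ) : ℂ) * f t := by
  rw [mellin]
  refine integral_congr_ae (Eventually.of_forall fun t => ?_)
  simp [Complex.cpow_neg_one]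

/-- Linear combinations of the derivatives at `s = 0` whose kernel vanishes at `t = 0`. -/
theorem sum_deriv_barnesZeta (ha : ∀ i, 0 < a i) {ι : Type*} (S : Finset ι) (c w : ι → ℂ)
    (hw : ∀ i ∈ S, 0 < (w i).re) {β : ℝ} (hβ : β < 0)
    (hH : (fun t : ℝ => ∑ i ∈ S, c i * (Complex.exp (-(w i * t)) * (barnesK a t : ℂ)))
      =O[𝓝[>] 0] fun t : ℝ => t ^ (-β)) :
    IntegrableOn (fun t : ℝ => ((t⁻¹ : ℝ) : ℂ) *
      ∑ i ∈ S, c i * (Complex.exp (-(w i * t)) * (barnesK a t : ℂ))) (Ioi 0) ∧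
    ∑ i ∈ S, c i * deriv (fun s => barnesZeta a s (w i)) 0 =
      ∫ t in Ioi (0 : ℝ), ((t⁻¹ : ℝ) : ℂ) *
        ∑ i ∈ S, c i * (Complex.exp (-(w i * t)) * (barnesK a t : ℂ)) := by
  set H : ℝ → ℂ := fun t => ∑ i ∈ S, c i * (Complex.exp (-(w i * t)) * (barnesK a t : ℂ)) with hHdef
  have hterm : ∀ i ∈ S, IsExpDecay (fun t : ℝ => c i * (Complex.exp (-(w i * t)) *
      (barnesK a t : ℂ))) M := fun i hi => ((isSubexp_barnesK ha).exp_mul (hw i hi)).const_mul _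
  have hHM : IsExpDecay H M := IsExpDecay.sum S hterm
  -- Each summand may have size t^(-M) at 0, but cancellation gives the sum the exponent β < 0. Its
  -- Mellin transform is therefore holomorphic near s = 0, where the separate integrals need not
  -- converge.
  have hHβ : IsExpDecay H β := ⟨hHM.1, hH, hHM.3⟩
  have hconv : MellinConvergent H 0 := hHβ.mellinConvergent (by simpa using hβ)
  refine ⟨?_, ?_⟩
  · refine IntegrableOn.congr_fun hconv (fun t _ => ?_) measurableSet_Ioi
    simp [H, Complex.cpow_neg_one]
  have hmain : EqOn (fun s => ∑ i ∈ S, c i * barnesZeta a s (w i))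
      (fun s => (Complex.Gamma s)⁻¹ * mellin H s) ({s : ℂ | β < s.re} \ barnesPoles M) := by
    refine eqOn_halfPlane_diff (d := M) (finite_barnesPoles M)
      (fun p hp => re_le_of_mem_barnesPoles hp) ?_ ?_ ?_
    · exact DifferentiableOn.fun_sum fun i hi =>
        ((barnesZeta_spec ha (hw i hi)).1.mono fun s hs => hs.2).const_mul _
    · exact fun s hs => ((Complex.differentiable_one_div_Gamma s).mul
        (hHβ.differentiableAt_mellin hs.1)).differentiableWithinAt
    · intro s hs
      have hs' : (M : ℝ) < s.re := hs
      have e : mellin H s = ∑ i ∈ S, c i * mellin (fun t : ℝ => Complex.exp (-(w i * t)) *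
          (barnesK a t : ℂ)) s := by
        have e3 : ∀ i ∈ S, c i * mellin (fun t : ℝ => Complex.exp (-(w i * t)) *
            (barnesK a t : ℂ)) s = ∫ t in Ioi (0 : ℝ), (t : ℂ) ^ (s - 1) •
            (c i * (Complex.exp (-(w i * t)) * (barnesK a t : ℂ))) := by
          intro i _
          rw [mellin, ← integral_const_mul]
          simp only [smul_eq_mul, mul_left_comm (c i)]
        rw [Finset.sum_congr rfl e3, ← integral_finsetSum _ fun i hi =>
          (hterm i hi).mellinConvergent hs']
        simp only [mellin, H, Finset.smul_sum]
      show ∑ i ∈ S, c i * barnesZeta a s (w i) = (Complex.Gamma s)⁻¹ * mellin H s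
      rw [e, Finset.mul_sum]
      refine Finset.sum_congr rfl fun i hi => ?_
      rw [(barnesZeta_spec ha (hw i hi)).2 s hs', zetaIntegral_eq]
      ring
  have hnhds : ({s : ℂ | β < s.re} \ barnesPoles M) ∈ 𝓝 (0 : ℂ) :=
    inter_mem ((isOpen_lt continuous_const Complex.continuous_re).mem_nhds (by simpa using hβ))
      (compl_barnesPoles_mem_nhds_zero M)
  have hderiv := (hasDerivAt_inv_Gamma_mul (hHβ.differentiableAt_mellin
    (s := 0) (by simpa using hβ))).congr_of_eventuallyEq (hmain.eventuallyEq_of_mem hnhds)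
  have hsum : HasDerivAt (fun s => ∑ i ∈ S, c i * barnesZeta a s (w i))
      (∑ i ∈ S, c i * deriv (fun s => barnesZeta a s (w i)) 0) 0 :=
    HasDerivAt.fun_sum fun i hi =>
      (differentiableAt_barnesZeta_zero ha (hw i hi)).hasDerivAt.const_mul _
  rw [hsum.unique hderiv, mellin_zero_eq]

/-- The difference equation of the Barnes zeta function, differentiated at `s = 0`. -/
theorem deriv_barnesZeta_succ {a : Fin (M + 1) → ℝ} (ha : ∀ i, 0 < a i) (hw : 0 < w.re) :
    deriv (fun s => barnesZeta a s w) 0 = deriv (fun s => barnesZeta a s (w + a (Fin.last M))) 0 +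
      deriv (fun s => barnesZeta (fun i : Fin M => a i.castSucc) s w) 0 := by
  have ha' : ∀ i : Fin M, 0 < a i.castSucc := fun i => ha _
  have hw' : 0 < (w + a (Fin.last M)).re := by simpa using add_pos hw (ha _)
  have hmain : EqOn (fun s => barnesZeta a s w)
      (fun s => barnesZeta a s (w + a (Fin.last M)) +
        barnesZeta (fun i : Fin M => a i.castSucc) s w)
      ({s : ℂ | -1 < s.re} \ barnesPoles (M + 1)) := by
    refine eqOn_halfPlane_diff (d := (M + 1 : ℕ)) (finite_barnesPoles _)
      (fun p hp => re_le_of_mem_barnesPoles hp) ((barnesZeta_spec ha hw).1.mono fun s hs => hs.2)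
      (((barnesZeta_spec ha hw').1.mono fun s hs => hs.2).add
        ((barnesZeta_spec ha' hw).1.mono fun s hs h => hs.2 (barnesPoles_mono M.le_succ h))) ?_
    intro s hs
    have hs' : ((M + 1 : ℕ) : ℝ) < s.re := hs
    have hs'' : (M : ℝ) < s.re := by push_cast at hs'; linarith
    show barnesZeta a s w = barnesZeta a s (w + a (Fin.last M)) +
        barnesZeta (fun i : Fin M => a i.castSucc) s w
    rw [(barnesZeta_spec ha hw).2 s hs', (barnesZeta_spec ha hw').2 s hs',
      (barnesZeta_spec ha' hw).2 s hs'', zetaIntegral_eq, zetaIntegral_eq, zetaIntegral_eq,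
      ← mul_add, ← (hasMellin_add (((isSubexp_barnesK ha).exp_mul hw').mellinConvergent hs')
        (((isSubexp_barnesK ha').exp_mul hw).mellinConvergent hs'')).2]
    congr 1
    refine setIntegral_congr_fun measurableSet_Ioi fun t ht => ?_
    have hne : (1 - Real.exp (-(a (Fin.last M) * t))) ≠ 0 := (one_sub_exp_pos (ha _) ht).ne'
    have hne' : (1 - Complex.exp (-((a (Fin.last M) : ℂ) * t))) ≠ 0 := by exact_mod_cast hne
    simp only [smul_eq_mul]
    congr 1
    rw [barnesK_succ, add_mul, neg_add, Complex.exp_add]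
    push_cast
    -- The identity behind the difference equation is 1/(1 - x) = x/(1 - x) + 1 with x = exp(-a_M
    -- t).
    linear_combination Complex.exp (-(w * t)) *
      (barnesK (fun i : Fin M => a i.castSucc) t : ℂ) * mul_inv_cancel₀ hne'
  have hnhds : ({s : ℂ | -1 < s.re} \ barnesPoles (M + 1)) ∈ 𝓝 (0 : ℂ) :=
    inter_mem ((isOpen_lt continuous_const Complex.continuous_re).mem_nhds (by simp))
      (compl_barnesPoles_mem_nhds_zero (M + 1))
  rw [(hmain.eventuallyEq_of_mem hnhds).deriv_eq]
  exact deriv_fun_add (differentiableAt_barnesZeta_zero ha hw')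
    (differentiableAt_barnesZeta_zero ha' hw)

/-- Near s = 0 the zeta function is given by `zetaCont`, whose derivative there is explicit in w:
powers of w, powers times log w, and a Laplace transform. -/
theorem differentiableOn_deriv_barnesZeta (ha : ∀ i, 0 < a i) :
    DifferentiableOn ℂ (fun w => deriv (fun s => barnesZeta a s w) 0) {w : ℂ | 0 < w.re} := by
  obtain ⟨c, hc⟩ := exists_barnesK_expansion ha
  -- With M + 1 terms removed the remainder is O(t), so its Mellin transform converges at s = 0 and
  -- ψ(t)/t is bounded near 0.
  set ψ : ℝ → ℂ := fun t => (barnesK a t : ℂ) -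
      ∑ k ∈ Finset.range (M + 1), c k * ((t ^ ((k : ℝ) - M) : ℝ) : ℂ) with hψdef
  have hψ : IsSubexp ψ (-1) := by
    have := hc (M + 1)
    convert this using 1
    push_cast
    ring
  have hformula : EqOn (fun w => deriv (fun s => barnesZeta a s w) 0) (fun w =>
      (∑ k ∈ Finset.range (M + 1), c k *
        (deriv (fun s => shiftProd M k s / shiftProd M M s) 0 * w ^ ((M : ℂ) - k - 0) +
          shiftProd M k 0 / shiftProd M M 0 * (w ^ ((M : ℂ) - k - 0) * Complex.log w * (-1)))) +
      ∫ t in Ioi (0 : ℝ), Complex.exp (-(w * t)) * (ψ t * ((t ^ (-1 : ℝ) : ℝ) : ℂ)))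
      {w : ℂ | 0 < w.re} := by
    intro w hw
    have hw' : 0 < w.re := hw
    have hw0 : w ≠ 0 := fun h => by simp [h] at hw'
    have hset : ({s : ℂ | (M : ℝ) - (M + 1 : ℕ) < s.re} \ barnesPoles M) ∈ 𝓝 (0 : ℂ) :=
      inter_mem ((isOpen_lt continuous_const Complex.continuous_re).mem_nhds (by simp))
        (compl_barnesPoles_mem_nhds_zero M)
    have heq : EqOn (fun s => barnesZeta a s w) (fun s => zetaCont a c (M + 1) s w)
        ({s : ℂ | (M : ℝ) - (M + 1 : ℕ) < s.re} \ barnesPoles M) :=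
      eqOn_halfPlane_diff (d := M) (finite_barnesPoles M)
        (fun p hp => re_le_of_mem_barnesPoles hp)
        ((barnesZeta_spec ha hw').1.mono fun s hs => hs.2)
        (differentiableOn_zetaCont hc hw' (M + 1)) fun s hs => by
          show barnesZeta a s w = _
          rw [(barnesZeta_spec ha hw').2 s hs, zetaIntegral_eq_zetaCont hc hw' (M + 1) hs]
    show deriv (fun s => barnesZeta a s w) 0 = _
    rw [(heq.eventuallyEq_of_mem hset).deriv_eq]
    have h1 : HasDerivAt (fun s => ∑ k ∈ Finset.range (M + 1), c k *
        (shiftProd M k s / shiftProd M M s * w ^ ((M : ℂ) - k - s)))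
        (∑ k ∈ Finset.range (M + 1), c k *
        (deriv (fun s => shiftProd M k s / shiftProd M M s) 0 * w ^ ((M : ℂ) - k - 0) +
          shiftProd M k 0 / shiftProd M M 0 *
            (w ^ ((M : ℂ) - k - 0) * Complex.log w * (-1)))) 0 := by
      refine HasDerivAt.fun_sum fun k _ => HasDerivAt.const_mul _ (HasDerivAt.fun_mul ?_ ?_)
      · exact ((differentiable_shiftProd M k 0).fun_div (differentiable_shiftProd M M 0)
          (shiftProd_self_ne_zero (zero_notMem_barnesPoles M))).hasDerivAt
      · exact ((hasDerivAt_id (0 : ℂ)).const_sub _).const_cpow (Or.inl hw0)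
    have h2 := hasDerivAt_inv_Gamma_mul ((hψ.exp_mul hw').differentiableAt_mellin
      (s := 0) (by simp))
    have h3 := (h1.fun_add h2).deriv
    rw [mellin_zero_eq] at h3
    refine h3.trans ?_
    congr 1
    refine integral_congr_ae (Eventually.of_forall fun t => ?_)
    simp only [Real.rpow_neg_one]
    ring
  refine DifferentiableOn.congr ?_ hformula
  refine DifferentiableOn.fun_add ?_ ?_
  · intro w hw
    have hs : w ∈ Complex.slitPlane := Or.inl hw
    have hp : ∀ z : ℂ, DifferentiableAt ℂ (fun w : ℂ => w ^ z) w := fun z =>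
      differentiableAt_id.cpow_const hs
    refine DifferentiableAt.differentiableWithinAt ?_
    refine DifferentiableAt.fun_sum fun k _ => DifferentiableAt.const_mul (DifferentiableAt.fun_add
      ((hp _).const_mul _) (DifferentiableAt.const_mul (DifferentiableAt.mul_const
        ((hp _).fun_mul (Complex.differentiableAt_log hs)) _) _)) _
  · exact (hψ.mul_rpow (-1)).differentiableOn_laplace (by norm_num)

end Continuation

/-! ### The Barnes multiple log-gamma function -/

theorem isPreconnected_slitPlane : IsPreconnected Complex.slitPlane :=
  (Complex.starConvex_one_slitPlane.isPathConnected
    Complex.one_mem_slitPlane).isConnected.isPreconnected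

theorem add_ofReal_mem_slitPlane {w : ℂ} (hw : w ∈ Complex.slitPlane) {r : ℝ} (hr : 0 ≤ r) :
    w + r ∈ Complex.slitPlane := by
  rw [Complex.mem_slitPlane_iff] at hw ⊢
  simp only [Complex.add_re, Complex.ofReal_re, Complex.add_im, Complex.ofReal_im, add_zero]
  exact hw.imp (fun h => by linarith) id

/-- For M = 0 the kernel is 1 and the zeta function is w^(-s). -/
theorem deriv_barnesZeta_fin_zero (a : Fin 0 → ℝ) {w : ℂ} (hw : 0 < w.re) :
    deriv (fun s => barnesZeta a s w) 0 = -Complex.log w := by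
  have ha : ∀ i, 0 < a i := fun i => i.elim0
  have hw0 : w ≠ 0 := fun h => by simp [h] at hw
  have hd : ∀ s, HasDerivAt (fun s : ℂ => w ^ (-s)) (w ^ (-s) * Complex.log w * (-1)) s :=
    fun s => (hasDerivAt_neg s).const_cpow (Or.inl hw0)
  have hmain : EqOn (fun s => barnesZeta a s w) (fun s => w ^ (-s))
      ({s : ℂ | -1 < s.re} \ barnesPoles 0) := by
    refine eqOn_halfPlane_diff (d := (0 : ℕ)) (finite_barnesPoles _)
      (fun p hp => re_le_of_mem_barnesPoles hp) ((barnesZeta_spec ha hw).1.mono fun s hs => hs.2)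
      (fun s _ => (hd s).differentiableAt.differentiableWithinAt) fun s hs => ?_
    have hs' : 0 < s.re := by simpa using hs
    have h := mellin_exp_mul_rpow hw (r := 0) (s := s) (by simpa using hs')
    simp only [Real.rpow_zero, Complex.ofReal_zero, add_zero] at h
    show barnesZeta a s w = w ^ (-s)
    rw [(barnesZeta_spec ha hw).2 s hs, zetaIntegral_eq]
    simp only [barnesK, Finset.univ_eq_empty, Finset.prod_empty]
    rw [h, inv_mul_cancel_left₀ (Complex.Gamma_ne_zero_of_re_pos hs')]
  have hnhds : ({s : ℂ | -1 < s.re} \ barnesPoles 0) ∈ 𝓝 (0 : ℂ) :=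
    inter_mem ((isOpen_lt continuous_const Complex.continuous_re).mem_nhds (by simp))
      (compl_barnesPoles_mem_nhds_zero 0)
  rw [(hmain.eventuallyEq_of_mem hnhds).deriv_eq, (hd 0).deriv]
  simp

/-- Induction on M. Iterating the difference equation n times expresses L_M(w) through L_M(w + n
a_M) and values of L_{M-1} at w, …, w + (n-1) a_M. The first term is defined for Re w > -n a_M and
the others on the slit plane, by induction. These half-planes exhaust ℂ. -/
theorem exists_logGamma_continuation {M : ℕ} {a : Fin M → ℝ} (ha : ∀ i, 0 < a i) :
    ∃ g : ℂ → ℂ, DifferentiableOn ℂ g Complex.slitPlane ∧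
      EqOn g (fun w => deriv (fun s => barnesZeta a s w) 0) {w : ℂ | 0 < w.re} := by
  induction M with
  | zero =>
    refine ⟨fun w => -Complex.log w, fun w hw =>
      (Complex.differentiableAt_log hw).neg.differentiableWithinAt, fun w hw => ?_⟩
    exact (deriv_barnesZeta_fin_zero a hw).symm
  | succ M ih =>
    obtain ⟨g, hg, hgL⟩ := ih (a := fun i : Fin M => a i.castSucc) fun i => ha _
    set α := a (Fin.last M) with hα
    have hα0 : 0 < α := ha _
    have hcast : ∀ n : ℕ, ((n : ℂ) * α) = ((n * α : ℝ) : ℂ) := fun n => by push_cast; rfl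
    obtain ⟨G, hG, hGn⟩ := exists_differentiableOn_iUnion
      (U := fun n : ℕ => {w : ℂ | -(n * α) < w.re} ∩ Complex.slitPlane)
      (g := fun n w => deriv (fun s => barnesZeta a s (w + n * α)) 0 +
        ∑ k ∈ Finset.range n, g (w + k * α))
      (fun n => (isOpen_lt continuous_const Complex.continuous_re).inter Complex.isOpen_slitPlane)
      (fun m n hmn w hw => ⟨by
        have h1 : -(m * α) < w.re := hw.1
        have h2 : (m : ℝ) * α ≤ n * α := by gcongr
        show -(n * α) < w.re
        linarith, hw.2⟩)
      (fun n => by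
        refine DifferentiableOn.fun_add ?_ (DifferentiableOn.fun_sum fun k _ => ?_)
        · refine (differentiableOn_deriv_barnesZeta ha).comp (g := fun w => _)
            (f := fun w : ℂ => w + n * α) (by fun_prop) fun w hw => ?_
          have h1 : -(n * α) < w.re := hw.1
          show 0 < (w + n * α).re
          rw [hcast, Complex.add_re, Complex.ofReal_re]
          linarith
        · refine hg.comp (f := fun w : ℂ => w + k * α) (by fun_prop) fun w hw => ?_
          show w + k * α ∈ Complex.slitPlane
          rw [hcast]
          exact add_ofReal_mem_slitPlane hw.2 (by positivity))
      (fun n w hw => by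
        have h1 : -(n * α) < w.re := hw.1
        have hpos : 0 < (w + n * α).re := by
          rw [hcast, Complex.add_re, Complex.ofReal_re]; linarith
        have h2 := deriv_barnesZeta_succ ha hpos
        have h3 := hgL hpos
        simp only at h3
        simp only [Finset.sum_range_succ]
        rw [h2, h3, ← hα, show w + ((n + 1 : ℕ) : ℂ) * α = w + n * α + α by push_cast; ring]
        ring)
    refine ⟨G, hG.mono fun w hw => ?_, fun w hw => ?_⟩
    · obtain ⟨n, hn⟩ := exists_nat_gt (-w.re / α)
      rw [div_lt_iff₀ hα0] at hn
      exact mem_iUnion.2 ⟨n, by show -(n * α) < w.re; linarith, hw⟩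
    · rw [hGn 0 ⟨by simpa using hw, Or.inl hw⟩]
      simp

section LogGamma

variable {M : ℕ} {a : Fin M → ℝ}

theorem barnesLogGamma_spec (ha : ∀ i, 0 < a i) :
    DifferentiableOn ℂ (barnesLogGamma a) Complex.slitPlane ∧ ∀ w : ℂ, 0 < w.re →
      barnesLogGamma a w = deriv (fun s => barnesZeta a s w) 0 := by
  obtain ⟨g, hg, hgL⟩ := exists_logGamma_continuation ha
  have hsub : {w : ℂ | 0 < w.re} ⊆ Complex.slitPlane := fun w hw => Or.inl hw
  have h : EqOn (barnesLogGamma a) g Complex.slitPlane :=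
    analyticContinuation_eqOn Complex.isOpen_slitPlane isPreconnected_slitPlane
      (isOpen_lt continuous_const Complex.continuous_re) ⟨1, by simp⟩ hsub hg hgL
  exact ⟨hg.congr h, fun w hw => (h (hsub hw)).trans (hgL hw)⟩

/-- Two holomorphic functions on the slit plane agree if they agree on the right half-plane. -/
theorem eqOn_slitPlane {f g : ℂ → ℂ} (hf : DifferentiableOn ℂ f Complex.slitPlane)
    (hg : DifferentiableOn ℂ g Complex.slitPlane) (h : ∀ w : ℂ, 0 < w.re → f w = g w) :
    EqOn f g Complex.slitPlane := by
  refine (hf.analyticOnNhd Complex.isOpen_slitPlane).eqOn_of_preconnected_of_eventuallyEq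
    (hg.analyticOnNhd Complex.isOpen_slitPlane) isPreconnected_slitPlane
    Complex.one_mem_slitPlane ?_
  filter_upwards [(isOpen_lt continuous_const Complex.continuous_re).mem_nhds
    (show (0 : ℝ) < (1 : ℂ).re by simp)] with w hw using h w hw

theorem barnesLogGamma_fin_zero (a : Fin 0 → ℝ) {w : ℂ} (hw : w ∈ Complex.slitPlane) :
    barnesLogGamma a w = -Complex.log w := by
  have hs := barnesLogGamma_spec (a := a) fun i => i.elim0
  exact eqOn_slitPlane (g := fun w => -Complex.log w) hs.1
    (fun w hw => (Complex.differentiableAt_log hw).neg.differentiableWithinAt)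
    (fun w hw => (hs.2 w hw).trans (deriv_barnesZeta_fin_zero a hw)) hw

/-- The difference equation of the Barnes multiple log-gamma function. -/
theorem barnesLogGamma_succ {a : Fin (M + 1) → ℝ} (ha : ∀ i, 0 < a i) {w : ℂ}
    (hw : w ∈ Complex.slitPlane) :
    barnesLogGamma a w = barnesLogGamma a (w + a (Fin.last M)) +
      barnesLogGamma (fun i : Fin M => a i.castSucc) w := by
  have ha' : ∀ i : Fin M, 0 < a i.castSucc := fun i => ha _
  have hs := barnesLogGamma_spec ha
  have hs' := barnesLogGamma_spec ha'
  refine eqOn_slitPlane (g := fun w => barnesLogGamma a (w + a (Fin.last M)) +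
    barnesLogGamma (fun i : Fin M => a i.castSucc) w) hs.1 (DifferentiableOn.fun_add ?_ hs'.1)
    (fun w hw => ?_) hw
  · exact hs.1.comp (f := fun w : ℂ => w + a (Fin.last M)) (by fun_prop)
      fun w hw => add_ofReal_mem_slitPlane hw (ha _).le
  · have hw' : 0 < (w + a (Fin.last M)).re := by simpa using add_pos hw (ha _)
    show _ = barnesLogGamma a (w + a (Fin.last M)) +
      barnesLogGamma (fun i : Fin M => a i.castSucc) w
    rw [hs.2 w hw, hs.2 _ hw', hs'.2 w hw, deriv_barnesZeta_succ ha hw]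

end LogGamma

/-! ### The operator `opS` -/

theorem opS_eq_sum_powerset {N : ℕ} (h : ℂ → ℂ) (q : ℂ) (b₀ : ℝ) (b : Fin N → ℝ) :
    opS h q b₀ b = ∑ k ∈ (Finset.univ : Finset (Fin N)).powerset,
      (-1 : ℂ) ^ k.card * h (q + (b₀ : ℂ) + ∑ j ∈ k, (b j : ℂ)) := by
  rw [opS, Finset.sum_powerset, Finset.card_univ, Fintype.card_fin]
  refine Finset.sum_congr rfl fun p _ => ?_
  rw [Finset.mul_sum]
  refine Finset.sum_congr rfl fun k hk => ?_
  rw [(Finset.mem_powersetCard.1 hk).2]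

theorem shift_mem_slitPlane {N : ℕ} {b : Fin N → ℝ} (hb : ∀ j, 0 < b j) {w : ℂ}
    (hw : w ∈ Complex.slitPlane) (k : Finset (Fin N)) :
    w + ∑ j ∈ k, (b j : ℂ) ∈ Complex.slitPlane := by
  rw [← Complex.ofReal_sum]
  exact add_ofReal_mem_slitPlane hw (Finset.sum_nonneg fun j _ => (hb j).le)

theorem opS_congr {N : ℕ} {b₀ : ℝ} {b : Fin N → ℝ} (hb : ∀ j, 0 < b j) {h h' : ℂ → ℂ} {q : ℂ}
    (hq : q + (b₀ : ℂ) ∈ Complex.slitPlane) (hh : ∀ w ∈ Complex.slitPlane, h w = h' w) :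
    opS h q b₀ b = opS h' q b₀ b := by
  rw [opS_eq_sum_powerset, opS_eq_sum_powerset]
  exact Finset.sum_congr rfl fun k _ => by rw [hh _ (shift_mem_slitPlane hb hq k)]

theorem opS_barnesLogGamma_succ {M N : ℕ} {a : Fin (M + 1) → ℝ} (ha : ∀ i, 0 < a i) {b₀ : ℝ}
    {b : Fin N → ℝ} (hb : ∀ j, 0 < b j) {q : ℂ} (hq : q + (b₀ : ℂ) ∈ Complex.slitPlane) :
    opS (barnesLogGamma a) q b₀ b = opS (barnesLogGamma a) (q + a (Fin.last M)) b₀ b +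
      opS (barnesLogGamma (fun i : Fin M => a i.castSucc)) q b₀ b := by
  simp only [opS_eq_sum_powerset]
  rw [← Finset.sum_add_distrib]
  refine Finset.sum_congr rfl fun k _ => ?_
  rw [barnesLogGamma_succ ha (shift_mem_slitPlane hb hq k), ← mul_add]
  congr 3
  ring

/-! ### The Lévy density -/

/-- The density
`exp (-b₀ t) * ∏ j, (1 - exp (-b_j t)) / ∏ i, (1 - exp (-a_i t)) / t` of the Lévy measure. -/
noncomputable def levyDensity {M N : ℕ} (a : Fin M → ℝ) (b₀ : ℝ) (b : Fin N → ℝ) (t : ℝ) : ℝ :=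
  t⁻¹ * (Real.exp (-(b₀ * t)) * ((∏ j, (1 - Real.exp (-(b j * t)))) * barnesK a t))

/-- The regular factor `∏ j, ((1 - exp (-b_j t)) / t) / ∏ i, ((1 - exp (-a_i t)) / t)`. -/
noncomputable def barnesRatio {M N : ℕ} (a : Fin M → ℝ) (b : Fin N → ℝ) (t : ℝ) : ℝ :=
  (∏ j, expQuot (b j) t) * ∏ i, (expQuot (a i) t)⁻¹

section Levy

variable {M N : ℕ} {a : Fin M → ℝ} {b₀ : ℝ} {b : Fin N → ℝ}

theorem levyDensity_pos (ha : ∀ i, 0 < a i) (hb : ∀ j, 0 < b j) {t : ℝ} (ht : 0 < t) :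
    0 < levyDensity a b₀ b t :=
  mul_pos (inv_pos.2 ht) (mul_pos (Real.exp_pos _) (mul_pos
    (Finset.prod_pos fun j _ => one_sub_exp_pos (hb j) ht) (barnesK_pos ha ht)))

theorem continuousOn_levyDensity (ha : ∀ i, 0 < a i) :
    ContinuousOn (levyDensity a b₀ b) (Ioi 0) :=
  (continuousOn_id.inv₀ fun _ ht => ne_of_gt ht).mul
    (ContinuousOn.mul (by fun_prop) (ContinuousOn.mul (by fun_prop) (continuousOn_barnesK ha)))

theorem analyticAt_barnesRatio (ha : ∀ i, 0 < a i) : AnalyticAt ℝ (barnesRatio a b) 0 :=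
  (Finset.analyticAt_fun_prod _ fun j _ => analyticAt_expQuot (b j)).mul
    (Finset.analyticAt_fun_prod _ fun i _ =>
      (analyticAt_expQuot (a i)).inv (by rw [expQuot_zero]; exact (ha i).ne'))

theorem prod_mul_barnesK_eq {t : ℝ} (ht : 0 < t) :
    (∏ j, (1 - Real.exp (-(b j * t)))) * barnesK a t =
      barnesRatio a b t * t ^ ((N : ℝ) - M) := by
  have h : ∏ j, (1 - Real.exp (-(b j * t))) = (∏ j, expQuot (b j) t) * t ^ (N : ℝ) := by
    have hN : t ^ (N : ℝ) = ∏ _j : Fin N, t := by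
      rw [Real.rpow_natCast, Finset.prod_const, Finset.card_univ, Fintype.card_fin]
    rw [hN, ← Finset.prod_mul_distrib]
    refine Finset.prod_congr rfl fun j _ => ?_
    rw [expQuot_of_ne ht.ne', div_mul_cancel₀ _ ht.ne']
  rw [h, barnesK_eq_expQuot a ht, barnesRatio, sub_eq_add_neg, Real.rpow_add ht]
  ring

/-- Expanding ∏ (1 - exp(-b_j t)) over subsets shows that 𝒮_N acts on exponentials as multiplication
by this product. -/
theorem sum_powerset_exp (w : ℂ) (b : Fin N → ℝ) (t : ℝ) :
    ∑ k ∈ (Finset.univ : Finset (Fin N)).powerset, (-1 : ℂ) ^ k.card *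
      Complex.exp (-((w + ∑ j ∈ k, (b j : ℂ)) * t)) =
      Complex.exp (-(w * t)) * ((∏ j, (1 - Real.exp (-(b j * t))) : ℝ) : ℂ) := by
  have h : ((∏ j, (1 - Real.exp (-(b j * t))) : ℝ) : ℂ) =
      ∏ j, (-Complex.exp (-(b j * t)) + 1) := by
    push_cast
    exact Finset.prod_congr rfl fun j _ => by ring
  rw [h, Finset.prod_add, Finset.mul_sum]
  refine Finset.sum_congr rfl fun k _ => ?_
  rw [Finset.prod_neg, ← Complex.exp_sum, add_mul, neg_add, Complex.exp_add, Finset.sum_mul,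
    Finset.sum_neg_distrib]
  simp only [Finset.prod_const_one, mul_one]
  ring

theorem prod_mul_barnesK_isBigO (ha : ∀ i, 0 < a i) :
    (fun t : ℝ => (((∏ j, (1 - Real.exp (-(b j * t)))) * barnesK a t : ℝ) : ℂ))
      =O[𝓝[>] 0] fun t : ℝ => t ^ ((N : ℝ) - M) := by
  have h1 : barnesRatio a b =O[𝓝[>] 0] fun _ : ℝ => (1 : ℝ) :=
    ((analyticAt_barnesRatio ha).continuousAt.mono_left nhdsWithin_le_nhds).isBigO_one ℝ
  have h2 := h1.mul (isBigO_refl (fun t : ℝ => t ^ ((N : ℝ) - M)) (𝓝[>] 0))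
  refine IsBigO.of_norm_left (h2.norm_left.congr' ?_ (Eventually.of_forall fun t => one_mul _))
  filter_upwards [self_mem_nhdsWithin] with t ht
  rw [Complex.norm_real, prod_mul_barnesK_eq ht]

theorem levyDensity_cast (q : ℂ) (t : ℝ) :
    Complex.exp (-(q * t)) * (levyDensity a b₀ b t : ℂ) = ((t⁻¹ : ℝ) : ℂ) *
      (Complex.exp (-((q + b₀) * t)) *
        (((∏ j, (1 - Real.exp (-(b j * t)))) * barnesK a t : ℝ) : ℂ)) := by
  rw [levyDensity, add_mul, neg_add, Complex.exp_add]
  push_cast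
  ring

/-- Integral representation of `opS L_M` for `M < N`. -/
theorem opS_barnesLogGamma_eq_integral (ha : ∀ i, 0 < a i) (hb : ∀ j, 0 < b j) (hMN : M < N)
    {q : ℂ} (hq : -b₀ < q.re) :
    IntegrableOn (fun t : ℝ => Complex.exp (-(q * t)) * (levyDensity a b₀ b t : ℂ)) (Ioi 0) ∧
    opS (barnesLogGamma a) q b₀ b =
      ∫ t in Ioi (0 : ℝ), Complex.exp (-(q * t)) * (levyDensity a b₀ b t : ℂ) := by
  have hre : ∀ k ∈ (Finset.univ : Finset (Fin N)).powerset,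
      0 < (q + (b₀ : ℂ) + ∑ j ∈ k, (b j : ℂ)).re := by
    intro k _
    rw [← Complex.ofReal_sum]
    simp only [Complex.add_re, Complex.ofReal_re]
    linarith [Finset.sum_nonneg fun j (_ : j ∈ k) => (hb j).le]
  have hfun : ∀ t : ℝ, ∑ k ∈ (Finset.univ : Finset (Fin N)).powerset, (-1 : ℂ) ^ k.card *
      (Complex.exp (-((q + (b₀ : ℂ) + ∑ j ∈ k, (b j : ℂ)) * t)) * (barnesK a t : ℂ)) =
      Complex.exp (-((q + b₀) * t)) *
        (((∏ j, (1 - Real.exp (-(b j * t)))) * barnesK a t : ℝ) : ℂ) := by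
    intro t
    simp only [← mul_assoc]
    rw [← Finset.sum_mul, sum_powerset_exp, Complex.ofReal_mul, mul_assoc]
  have hcast : (0 : ℝ) < (N : ℝ) - M := sub_pos.2 (by exact_mod_cast hMN)
  obtain ⟨h1, h2⟩ := sum_deriv_barnesZeta ha (Finset.univ : Finset (Fin N)).powerset
    (fun k => (-1 : ℂ) ^ k.card) (fun k => q + (b₀ : ℂ) + ∑ j ∈ k, (b j : ℂ)) hre
    -- N zeros against M poles leave the order N - M at t = 0, which is positive because M < N.
    (β := -((N : ℝ) - M)) (by linarith) (by
      simp only [hfun, neg_neg]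
      exact ((cexp_isBigO_one (q + b₀)).mul (prod_mul_barnesK_isBigO ha)).congr_right
        fun t => one_mul _)
  simp only [hfun, ← levyDensity_cast] at h1 h2
  refine ⟨h1, ?_⟩
  rw [← h2, opS_eq_sum_powerset]
  exact Finset.sum_congr rfl fun k hk => by rw [(barnesLogGamma_spec ha).2 _ (hre k hk)]

theorem cexp_sub_one_isBigO (q : ℂ) :
    (fun t : ℝ => Complex.exp (-(q * t)) - 1) =O[𝓝[>] 0] fun t : ℝ => t := by
  have h : HasDerivAt (fun t : ℝ => Complex.exp (-(q * t))) (-q) 0 := by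
    have h1 : HasDerivAt (fun t : ℝ => -(q * (t : ℂ))) (-q) 0 := by
      simpa using ((Complex.ofRealCLM.hasDerivAt (x := (0 : ℝ))).const_mul q).fun_neg
    simpa using h1.cexp
  have := h.differentiableAt.isBigO_sub.mono (nhdsWithin_le_nhds (s := Ioi 0))
  simpa using this

/-- Integral representation of the increments of `opS L_M` for `M ≤ N`. -/
theorem opS_barnesLogGamma_sub_eq_integral (ha : ∀ i, 0 < a i) (hb₀ : 0 < b₀)
    (hb : ∀ j, 0 < b j) (hMN : M ≤ N) {q : ℂ} (hq : -b₀ < q.re) :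
    IntegrableOn (fun t : ℝ => (Complex.exp (-(q * t)) - 1) * (levyDensity a b₀ b t : ℂ)) (Ioi 0) ∧
    opS (barnesLogGamma a) q b₀ b - opS (barnesLogGamma a) 0 b₀ b =
      ∫ t in Ioi (0 : ℝ), (Complex.exp (-(q * t)) - 1) * (levyDensity a b₀ b t : ℂ) := by
  -- The Boolean index puts the values at q (`true`, sign +) and at 0 (`false`, sign -) into one
  -- linear combination, since for M = N neither kernel alone vanishes at t = 0.
  set S := (Finset.univ : Finset (Fin N)).powerset ×ˢ (Finset.univ : Finset Bool) with hS
  have hre : ∀ r : ℂ, -b₀ < r.re → ∀ k : Finset (Fin N),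
      0 < (r + (b₀ : ℂ) + ∑ j ∈ k, (b j : ℂ)).re := by
    intro r hr k
    rw [← Complex.ofReal_sum]
    simp only [Complex.add_re, Complex.ofReal_re]
    linarith [Finset.sum_nonneg fun j (_ : j ∈ k) => (hb j).le]
  have h0 : -b₀ < (0 : ℂ).re := by simpa using hb₀
  have hreS : ∀ i ∈ S, 0 < (cond i.2 q 0 + (b₀ : ℂ) + ∑ j ∈ i.1, (b j : ℂ)).re := by
    rintro ⟨k, x⟩ _
    cases x
    exacts [hre 0 h0 k, hre q hq k]
  have hfun : ∀ t : ℝ, ∑ i ∈ S, ((-1 : ℂ) ^ i.1.card * cond i.2 1 (-1)) *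
      (Complex.exp (-((cond i.2 q 0 + (b₀ : ℂ) + ∑ j ∈ i.1, (b j : ℂ)) * t)) *
        (barnesK a t : ℂ)) =
      (Complex.exp (-((q + b₀) * t)) - Complex.exp (-((0 + b₀) * t))) *
        (((∏ j, (1 - Real.exp (-(b j * t)))) * barnesK a t : ℝ) : ℂ) := by
    intro t
    have e := fun r : ℂ => sum_powerset_exp (r + b₀) b t
    rw [Complex.ofReal_mul, ← mul_assoc, sub_mul, ← e q, ← e 0, hS, Finset.sum_product,
      ← Finset.sum_sub_distrib, Finset.sum_mul]
    refine Finset.sum_congr rfl fun k _ => ?_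
    rw [Fintype.sum_bool]
    simp only [cond_true, cond_false]
    ring
  have hfac : ∀ t : ℝ, Complex.exp (-((q + b₀) * t)) - Complex.exp (-((0 + b₀) * t)) =
      Complex.exp (-(b₀ * t)) * (Complex.exp (-(q * t)) - 1) := by
    intro t
    rw [add_mul, neg_add, Complex.exp_add, zero_add]
    ring
  have hcast : (0 : ℝ) ≤ (N : ℝ) - M := sub_nonneg.2 (by exact_mod_cast hMN)
  obtain ⟨h1, h2⟩ := sum_deriv_barnesZeta ha S
    (fun i => (-1 : ℂ) ^ i.1.card * cond i.2 1 (-1))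
    (fun i => cond i.2 q 0 + (b₀ : ℂ) + ∑ j ∈ i.1, (b j : ℂ)) hreS
    -- The factor exp(-qt) - 1 = O(t) supplies the extra order of vanishing that admits M = N.
    (β := -(1 + ((N : ℝ) - M))) (by linarith) (by
      simp only [hfun, hfac, neg_neg]
      refine (((cexp_isBigO_one b₀).mul (cexp_sub_one_isBigO q)).mul
        (prod_mul_barnesK_isBigO ha)).congr' (EventuallyEq.refl _ _) ?_
      filter_upwards [self_mem_nhdsWithin] with t ht
      rw [Real.rpow_add ht, Real.rpow_one, one_mul])
  have hdens : ∀ t : ℝ, ((t⁻¹ : ℝ) : ℂ) *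
      ((Complex.exp (-((q + b₀) * t)) - Complex.exp (-((0 + b₀) * t))) *
        (((∏ j, (1 - Real.exp (-(b j * t)))) * barnesK a t : ℝ) : ℂ)) =
      (Complex.exp (-(q * t)) - 1) * (levyDensity a b₀ b t : ℂ) := by
    intro t
    have e0 := levyDensity_cast (a := a) (b₀ := b₀) (b := b) 0 t
    simp only [zero_mul, neg_zero, Complex.exp_zero, one_mul] at e0
    rw [sub_mul _ _ (levyDensity a b₀ b t : ℂ), levyDensity_cast, one_mul, e0]
    ring
  simp only [hfun, hdens] at h1 h2
  refine ⟨h1, ?_⟩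
  rw [← h2, opS_eq_sum_powerset, opS_eq_sum_powerset, hS, Finset.sum_product,
    ← Finset.sum_sub_distrib]
  refine Finset.sum_congr rfl fun k hk => ?_
  rw [Fintype.sum_bool, (barnesLogGamma_spec ha).2 _ (hre q hq k),
    (barnesLogGamma_spec ha).2 _ (hre 0 h0 k)]
  simp only [cond_true, cond_false]
  ring

end Levy

/-! ### Sums over the lattice -/

/-- Splitting off the slice with first coordinate 0 mirrors the difference equation: the slice gives
the L_{M-1} term and the rest is the shifted lattice. -/
theorem hasSum_nat_prod {α : Type*} {f : ℕ × α → ℂ} {A B : ℂ} (h0 : HasSum (fun n => f (0, n)) A)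
    (h1 : HasSum (fun p : ℕ × α => f (p.1 + 1, p.2)) B) : HasSum f (A + B) := by
  have hi0 : Function.Injective (fun n : α => ((0, n) : ℕ × α)) := fun m n h => by simpa using h
  have hi1 : Function.Injective (fun p : ℕ × α => ((p.1 + 1, p.2) : ℕ × α)) := fun p p' h => by
    simpa [Prod.ext_iff] using h
  refine HasSum.add_isCompl (s := range fun n : α => ((0, n) : ℕ × α))
    (t := range fun p : ℕ × α => ((p.1 + 1, p.2) : ℕ × α)) ?_
    (hi0.hasSum_range_iff.2 h0) (hi1.hasSum_range_iff.2 h1)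
  rw [isCompl_iff, disjoint_left, codisjoint_iff_le_sup]
  refine ⟨?_, ?_⟩
  · rintro _ ⟨n, rfl⟩ ⟨p, hp⟩
    simp at hp
  · rintro ⟨_ | k, n⟩ _
    exacts [Or.inl ⟨n, rfl⟩, Or.inr ⟨(k, n), rfl⟩]

theorem latticeSum_snocEquiv {M : ℕ} (a : Fin (M + 1) → ℝ) (p : ℕ × (Fin M → ℕ)) :
    latticeSum a (Fin.snocEquiv (fun _ => ℕ) p) =
      p.1 * a (Fin.last M) + latticeSum (fun i : Fin M => a i.castSucc) p.2 := by
  simp [latticeSum, Fin.sum_univ_castSucc, Fin.snocEquiv, add_comm]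

theorem latticeSum_nonneg {M : ℕ} {a : Fin M → ℝ} (ha : ∀ i, 0 < a i) (n : Fin M → ℕ) :
    0 ≤ latticeSum a n :=
  Finset.sum_nonneg fun i _ => mul_nonneg (Nat.cast_nonneg _) (ha i).le

/-- The kernel is the generating function of the lattice. -/
theorem hasSum_exp_latticeSum {M : ℕ} {a : Fin M → ℝ} (ha : ∀ i, 0 < a i) {t : ℝ} (ht : 0 < t) :
    HasSum (fun n : Fin M → ℕ => Real.exp (-(latticeSum a n * t))) (barnesK a t) := by
  induction M with
  | zero =>
    simp [latticeSum, barnesK]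
  | succ M ih =>
    have hg : HasSum (fun k : ℕ => Real.exp (-(a (Fin.last M) * t)) ^ k)
        (1 - Real.exp (-(a (Fin.last M) * t)))⁻¹ :=
      hasSum_geometric_of_lt_one (Real.exp_nonneg _)
        (by linarith [one_sub_exp_pos (ha (Fin.last M)) ht])
    have hM := ih (a := fun i : Fin M => a i.castSucc) fun i => ha _
    rw [barnesK_succ, mul_comm, ← (Fin.snocEquiv (fun _ => ℕ)).hasSum_iff]
    have hprod := hg.mul hM (hg.summable.mul_of_nonneg hM.summable
      (fun k => pow_nonneg (Real.exp_nonneg _) k) fun n => Real.exp_nonneg _)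
    refine hprod.congr_fun fun p => ?_
    rw [Function.comp_apply, latticeSum_snocEquiv, ← Real.exp_nat_mul, ← Real.exp_add]
    congr 1
    ring

section

variable {M N : ℕ} {b₀ : ℝ} {b : Fin N → ℝ}

theorem levyDensity_eq_mul_barnesK (a : Fin M → ℝ) (a₀ : Fin 0 → ℝ) (t : ℝ) :
    levyDensity a b₀ b t = levyDensity a₀ b₀ b t * barnesK a t := by
  simp only [levyDensity, barnesK, Finset.univ_eq_empty, Finset.prod_empty]
  ring

/-- Each summand is 𝒮_N L_0 at q + Ω, hence an integral against the density with M = 0. Summing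
exp(-Ωt) over the lattice restores K(t). -/
theorem hasSum_opS_log_of_re {a : Fin M → ℝ} (ha : ∀ i, 0 < a i) (hb : ∀ j, 0 < b j)
    (hMN : M < N) {q : ℂ} (hq : -b₀ < q.re) :
    HasSum (fun n : Fin M → ℕ => opS (fun w => -Complex.log w) (q + latticeSum a n) b₀ b)
      (opS (barnesLogGamma a) q b₀ b) := by
  have hN : 0 < N := by omega
  have h0 : ∀ i : Fin 0, 0 < (Fin.elim0 : Fin 0 → ℝ) i := fun i => i.elim0
  have hre : ∀ n : Fin M → ℕ, -b₀ < (q + (latticeSum a n : ℂ)).re := fun n => by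
    rw [Complex.add_re, Complex.ofReal_re]
    linarith [latticeSum_nonneg ha n]
  have hterm : ∀ n : Fin M → ℕ, opS (fun w => -Complex.log w) (q + latticeSum a n) b₀ b =
      ∫ t in Ioi (0 : ℝ), Complex.exp (-((q + latticeSum a n) * t)) *
        (levyDensity (Fin.elim0 : Fin 0 → ℝ) b₀ b t : ℂ) := by
    intro n
    rw [← (opS_barnesLogGamma_eq_integral h0 hb hN (hre n)).2]
    refine (opS_congr hb (Or.inl ?_) fun w hw => barnesLogGamma_fin_zero _ hw).symm
    rw [Complex.add_re, Complex.ofReal_re]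
    linarith [hre n]
  obtain ⟨hint, hval⟩ := opS_barnesLogGamma_eq_integral ha hb hMN hq
  rw [hval, funext hterm]
  -- The norms of the summands form a nonnegative series whose sum is the norm of the limiting
  -- integrand, so integrability of the latter justifies the interchange.
  have hsum : ∀ t : ℝ, 0 < t → HasSum (fun n : Fin M → ℕ => Real.exp (-(q.re * t)) *
      levyDensity (Fin.elim0 : Fin 0 → ℝ) b₀ b t * Real.exp (-(latticeSum a n * t)))
      (Real.exp (-(q.re * t)) * levyDensity (Fin.elim0 : Fin 0 → ℝ) b₀ b t * barnesK a t) :=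
    fun t ht => (hasSum_exp_latticeSum ha ht).mul_left _
  refine hasSum_integral_of_dominated_convergence
    (fun n t => Real.exp (-(q.re * t)) * levyDensity (Fin.elim0 : Fin 0 → ℝ) b₀ b t *
      Real.exp (-(latticeSum a n * t))) (fun n => ?_) (fun n => ?_) ?_ ?_ ?_
  · exact (opS_barnesLogGamma_eq_integral h0 hb hN (hre n)).1.aestronglyMeasurable
  · refine (ae_restrict_iff' measurableSet_Ioi).2 (Eventually.of_forall fun t ht => le_of_eq ?_)
    rw [norm_mul, norm_cexp_neg_mul, Complex.norm_real,
      Real.norm_of_nonneg (levyDensity_pos h0 hb ht).le, Complex.add_re, Complex.ofReal_re,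
      add_mul, neg_add, Real.exp_add]
    ring
  · exact (ae_restrict_iff' measurableSet_Ioi).2
      (Eventually.of_forall fun t ht => (hsum t ht).summable)
  · refine hint.norm.congr ((ae_restrict_iff' measurableSet_Ioi).2
      (Eventually.of_forall fun t ht => ?_))
    simp only
    rw [(hsum t ht).tsum_eq, norm_mul, norm_cexp_neg_mul, Complex.norm_real,
      Real.norm_of_nonneg (levyDensity_pos ha hb ht).le,
      levyDensity_eq_mul_barnesK a (Fin.elim0 : Fin 0 → ℝ)]
    ring
  · refine (ae_restrict_iff' measurableSet_Ioi).2 (Eventually.of_forall fun t ht => ?_)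
    have h := ((Complex.hasSum_ofReal.2 (hasSum_exp_latticeSum ha ht)).mul_left
      (Complex.exp (-(q * t)) * (levyDensity (Fin.elim0 : Fin 0 → ℝ) b₀ b t : ℂ)))
    rw [mul_assoc, ← Complex.ofReal_mul, ← levyDensity_eq_mul_barnesK] at h
    refine h.congr_fun fun n => ?_
    rw [add_mul, neg_add, Complex.exp_add]
    push_cast
    ring

/-- The action of `opS` on the Barnes log-gamma function. -/
theorem hasSum_opS_log {a : Fin M → ℝ} (ha : ∀ i, 0 < a i) (hb : ∀ j, 0 < b j) (hMN : M < N)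
    {q : ℂ} (hq : q + (b₀ : ℂ) ∈ Complex.slitPlane) :
    HasSum (fun n : Fin M → ℕ => opS (fun w => -Complex.log w) (q + latticeSum a n) b₀ b)
      (opS (barnesLogGamma a) q b₀ b) := by
  induction M generalizing q with
  | zero =>
    rw [opS_congr hb hq fun w hw => barnesLogGamma_fin_zero a hw]
    simp [latticeSum]
  | succ M ih =>
    have ha' : ∀ i : Fin M, 0 < a i.castSucc := fun i => ha _
    set α := a (Fin.last M) with hα
    have hα0 : 0 < α := ha _
    have hstep : ∀ q : ℂ, q + (b₀ : ℂ) ∈ Complex.slitPlane →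
        HasSum (fun n : Fin (M + 1) → ℕ =>
          opS (fun w => -Complex.log w) (q + α + latticeSum a n) b₀ b)
          (opS (barnesLogGamma a) (q + α) b₀ b) →
        HasSum (fun n : Fin (M + 1) → ℕ =>
          opS (fun w => -Complex.log w) (q + latticeSum a n) b₀ b)
          (opS (barnesLogGamma a) q b₀ b) := by
      intro q hq h
      rw [← (Fin.snocEquiv (fun _ => ℕ)).hasSum_iff] at h ⊢
      rw [opS_barnesLogGamma_succ ha hb hq, add_comm (opS _ _ _ _)]
      refine hasSum_nat_prod ((ih ha' (by omega) hq).congr_fun fun n => ?_)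
        (h.congr_fun fun p => ?_)
      · rw [Function.comp_apply, latticeSum_snocEquiv]
        simp
      · rw [Function.comp_apply, Function.comp_apply, latticeSum_snocEquiv, latticeSum_snocEquiv]
        congr 1
        push_cast
        ring
    -- After enough shifts by a_M the point lies in the half-plane where the integral representation
    -- holds; the difference equation then brings the identity back to q.
    have hiter : ∀ n : ℕ, ∀ q : ℂ, q + (b₀ : ℂ) ∈ Complex.slitPlane → -b₀ < q.re + n * α →
        HasSum (fun n : Fin (M + 1) → ℕ =>
          opS (fun w => -Complex.log w) (q + latticeSum a n) b₀ b)
          (opS (barnesLogGamma a) q b₀ b) := by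
      intro n
      induction n with
      | zero => exact fun q _ h => hasSum_opS_log_of_re ha hb hMN (by simpa using h)
      | succ n ihn =>
        intro q hq h
        refine hstep q hq (ihn (q + α) ?_ ?_)
        · rw [add_right_comm]
          exact add_ofReal_mem_slitPlane hq hα0.le
        · rw [Complex.add_re, Complex.ofReal_re]
          push_cast at h
          linarith
    obtain ⟨n, hn⟩ := exists_nat_gt ((-b₀ - q.re) / α)
    rw [div_lt_iff₀ hα0] at hn
    exact hiter n q hq (by linarith)

/-! ### Alternating products as exponentials -/

theorem altProd_eq_exp (hb : ∀ j, 0 < b j) {q : ℂ} (hq : q + (b₀ : ℂ) ∈ Complex.slitPlane) :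
    altProd (q + (b₀ : ℂ)) (fun j => (b j : ℂ)) =
      Complex.exp (-opS (fun w => -Complex.log w) q b₀ b) := by
  rw [altProd, opS, ← Finset.sum_neg_distrib, Complex.exp_sum]
  refine Finset.prod_congr rfl fun p _ => ?_
  have h : ∏ k ∈ Finset.powersetCard p (Finset.univ : Finset (Fin N)),
      (q + (b₀ : ℂ) + ∑ j ∈ k, (b j : ℂ)) =
      Complex.exp (∑ k ∈ Finset.powersetCard p (Finset.univ : Finset (Fin N)),
        Complex.log (q + (b₀ : ℂ) + ∑ j ∈ k, (b j : ℂ))) := by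
    rw [Complex.exp_sum]
    exact Finset.prod_congr rfl fun k _ =>
      (Complex.exp_log (Complex.slitPlane_ne_zero (shift_mem_slitPlane hb hq k))).symm
  rw [h, ← Complex.exp_int_mul, Finset.sum_neg_distrib]
  push_cast
  ring_nf

theorem hasProd_altProd {a : Fin M → ℝ} (ha : ∀ i, 0 < a i) (hb : ∀ j, 0 < b j) (hMN : M < N)
    {q : ℂ} (hq : q + (b₀ : ℂ) ∈ Complex.slitPlane) :
    HasProd (fun n : Fin M → ℕ => altProd (q + (b₀ : ℂ) + (latticeSum a n : ℂ))
      (fun j => (b j : ℂ))) (Complex.exp (-opS (barnesLogGamma a) q b₀ b)) := by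
  refine (hasSum_opS_log ha hb hMN hq).neg.cexp.congr_fun fun n => ?_
  rw [Function.comp_apply, add_right_comm q]
  refine altProd_eq_exp hb ?_
  rw [add_right_comm]
  exact add_ofReal_mem_slitPlane hq (latticeSum_nonneg ha n)

theorem altProd_pos {x : ℝ} (hx : 0 < x) (hb : ∀ j, 0 < b j) : 0 < altProd x b :=
  Finset.prod_pos fun _ _ => zpow_pos (Finset.prod_pos fun _ _ =>
    add_pos_of_pos_of_nonneg hx (Finset.sum_nonneg fun j _ => (hb j).le)) _

theorem ofReal_altProd (x : ℝ) (b : Fin N → ℝ) :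
    ((altProd x b : ℝ) : ℂ) = altProd (x : ℂ) (fun j => (b j : ℂ)) := by
  simp [altProd]

/-- The real form of the product formula. -/
theorem hasProd_altProd_real {a : Fin M → ℝ} (ha : ∀ i, 0 < a i) (hb₀ : 0 < b₀)
    (hb : ∀ j, 0 < b j) (hMN : M < N) {x : ℝ} (hx : 0 ≤ x) :
    ∃ p : ℝ, HasProd (fun n : Fin M → ℕ => altProd (x + b₀ + latticeSum a n) b) p ∧
      (p : ℂ) = Complex.exp (-opS (barnesLogGamma a) x b₀ b) := by
  have hq : (x : ℂ) + (b₀ : ℂ) ∈ Complex.slitPlane := Or.inl (by simpa using by positivity)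
  have h := hasProd_altProd ha hb hMN hq
  have hpos : ∀ n : Fin M → ℕ, 0 < altProd (x + b₀ + latticeSum a n) b := fun n =>
    altProd_pos (by linarith [latticeSum_nonneg ha n]) hb
  have e : (fun n : Fin M → ℕ => altProd ((x : ℂ) + (b₀ : ℂ) + (latticeSum a n : ℂ))
      (fun j => (b j : ℂ))) = fun n => ((altProd (x + b₀ + latticeSum a n) b : ℝ) : ℂ) := by
    funext n
    rw [ofReal_altProd]
    push_cast
    rfl
  rw [e] at h
  -- The factors are positive reals, so taking norms yields a real product without first knowing
  -- that the complex limit is real.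
  have hn := h.norm
  simp only [Complex.norm_real, Real.norm_of_nonneg (hpos _).le] at hn
  refine ⟨_, hn, ?_⟩
  refine HasProd.unique ?_ h
  have := hn.map Complex.ofRealHom Complex.continuous_ofReal
  simpa [Function.comp_def] using this

end

/-! ### Laplace transforms of probability measures on `[0, ∞)` -/

section Conv

variable {𝕜 : Type*} [RCLike 𝕜] {f : ℝ → 𝕜}

/-- An additive-to-multiplicative function separates on x + y, so Fubini factors the integral. The
scalar field is left general to cover both exp(-qx) and its norm. -/
theorem integral_conv_of_map_add (hf : Continuous f) (hadd : ∀ x y, f (x + y) = f x * f y)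
    {μ ν : Measure ℝ} [SFinite μ] [SFinite ν] (hμ : Integrable f μ) (hν : Integrable f ν) :
    Integrable f (μ.conv ν) ∧ ∫ x, f x ∂(μ.conv ν) = (∫ x, f x ∂μ) * ∫ x, f x ∂ν := by
  have hm : AEMeasurable (fun p : ℝ × ℝ => p.1 + p.2) (μ.prod ν) := by fun_prop
  have h := hμ.mul_prod hν
  simp only [← hadd] at h
  refine ⟨(integrable_map_measure hf.aestronglyMeasurable hm).2 h, ?_⟩
  rw [Measure.conv, integral_map hm hf.aestronglyMeasurable]
  simp only [hadd]
  exact integral_prod_mul f f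

theorem conv_Iio_zero {μ ν : Measure ℝ} [SFinite μ] [SFinite ν] (hμ : μ (Iio 0) = 0)
    (hν : ν (Iio 0) = 0) : (μ.conv ν) (Iio 0) = 0 := by
  rw [Measure.conv, Measure.map_apply (by fun_prop) measurableSet_Iio]
  refine measure_mono_null (t := (Iio 0 ×ˢ univ) ∪ (univ ×ˢ Iio 0)) ?_ ?_
  · rintro ⟨x, y⟩ h
    have h' : x + y < 0 := h
    by_contra hc
    simp only [mem_union, mem_prod, mem_Iio, mem_univ, and_true, true_and, not_or, not_lt] at hc
    linarith
  · rw [measure_union_null_iff, Measure.prod_prod, Measure.prod_prod, hμ, hν]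
    simp

/-- Convolution powers. -/
noncomputable def convPow (ν : Measure ℝ) : ℕ → Measure ℝ
  | 0 => Measure.dirac 0
  | n + 1 => (convPow ν n).conv ν

theorem isFiniteMeasure_convPow (ν : Measure ℝ) [IsFiniteMeasure ν] (n : ℕ) :
    IsFiniteMeasure (convPow ν n) := by
  induction n with
  | zero => exact inferInstanceAs (IsFiniteMeasure (Measure.dirac (0 : ℝ)))
  | succ n ih => exact inferInstanceAs (IsFiniteMeasure ((convPow ν n).conv ν))

theorem convPow_Iio_zero {ν : Measure ℝ} [IsFiniteMeasure ν] (hν : ν (Iio 0) = 0) (n : ℕ) :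
    convPow ν n (Iio 0) = 0 := by
  induction n with
  | zero => simp [convPow]
  | succ n ih =>
    have := isFiniteMeasure_convPow ν n
    exact conv_Iio_zero ih hν

theorem integral_convPow (hf : Continuous f) (h0 : f 0 = 1)
    (hadd : ∀ x y, f (x + y) = f x * f y) {ν : Measure ℝ} [IsFiniteMeasure ν]
    (hν : Integrable f ν) (n : ℕ) :
    Integrable f (convPow ν n) ∧ ∫ x, f x ∂(convPow ν n) = (∫ x, f x ∂ν) ^ n := by
  induction n with
  | zero =>
    refine ⟨?_, by simp [convPow, h0]⟩
    rw [convPow]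
    exact integrable_dirac (by simp)
  | succ n ih =>
    have := isFiniteMeasure_convPow ν n
    have h := integral_conv_of_map_add hf hadd ih.1 hν
    rw [convPow, pow_succ, ← ih.2]
    exact h

end Conv

/-- The compound Poisson distribution with Lévy measure `ν`. -/
noncomputable def compoundPoisson (ν : Measure ℝ) : Measure ℝ :=
  Measure.sum fun n : ℕ => ENNReal.ofReal (Real.exp (-ν.real univ) / n.factorial) • convPow ν n

/-- A probability measure on `[0, ∞)` whose Laplace transform is `Λ` for `Re q > -b₀`. -/
structure HasLaplace (μ : Measure ℝ) (b₀ : ℝ) (Λ : ℂ → ℂ) : Prop where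
  isProbabilityMeasure : IsProbabilityMeasure μ
  support : μ (Iio 0) = 0
  integrable : ∀ q : ℂ, -b₀ < q.re → Integrable (fun x : ℝ => Complex.exp (-(q * x))) μ
  laplace : ∀ q : ℂ, -b₀ < q.re → ∫ x : ℝ, Complex.exp (-(q * x)) ∂μ = Λ q

/-- The Laplace transform at q = 0 is the total mass. -/
theorem isProbabilityMeasure_of_laplace {μ : Measure ℝ}
    (h : Integrable (fun x : ℝ => Complex.exp (-((0 : ℂ) * x))) μ)
    (h1 : ∫ x : ℝ, Complex.exp (-((0 : ℂ) * x)) ∂μ = 1) : IsProbabilityMeasure μ := by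
  simp only [zero_mul, neg_zero, Complex.exp_zero] at h h1
  have hfin : IsFiniteMeasure μ := (integrable_const_iff_isFiniteMeasure one_ne_zero).1 h
  rw [integral_const, Complex.real_smul, mul_one] at h1
  have h2 : μ.real univ = 1 := by exact_mod_cast h1
  exact ⟨by rw [← ENNReal.toReal_eq_one_iff]; exact h2⟩

theorem cexp_neg_mul_add (q : ℂ) (x y : ℝ) :
    Complex.exp (-(q * ((x + y : ℝ) : ℂ))) =
      Complex.exp (-(q * x)) * Complex.exp (-(q * y)) := by
  rw [← Complex.exp_add]
  push_cast
  ring_nf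

theorem HasLaplace.conv {μ ν : Measure ℝ} {b₀ : ℝ} {Λ Λ' : ℂ → ℂ} (hμ : HasLaplace μ b₀ Λ)
    (hν : HasLaplace ν b₀ Λ') : HasLaplace (μ.conv ν) b₀ fun q => Λ q * Λ' q := by
  have := hμ.1
  have := hν.1
  have h := fun q : ℂ => fun hq : -b₀ < q.re =>
    integral_conv_of_map_add (f := fun x : ℝ => Complex.exp (-(q * x))) (by fun_prop)
      (cexp_neg_mul_add q) (hμ.3 q hq) (hν.3 q hq)
  exact ⟨inferInstance, conv_Iio_zero hμ.2 hν.2, fun q hq => (h q hq).1, fun q hq => by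
    rw [(h q hq).2, hμ.4 q hq, hν.4 q hq]⟩

/-- The n-th convolution power has transform (∫ exp(-qx) dν)^n, so the Poisson weights sum to an
exponential series. The prefactor exp(-ν(ℝ)) supplies the -1 in the exponent, and the same series at
Re q gives integrability. -/
theorem hasLaplace_compoundPoisson {ν : Measure ℝ} [IsFiniteMeasure ν] (hν : ν (Iio 0) = 0)
    {b₀ : ℝ} (hb₀ : 0 < b₀)
    (hint : ∀ q : ℂ, -b₀ < q.re → Integrable (fun x : ℝ => Complex.exp (-(q * x))) ν) :
    HasLaplace (compoundPoisson ν) b₀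
      fun q => Complex.exp (∫ x : ℝ, (Complex.exp (-(q * x)) - 1) ∂ν) := by
  have hcoef : ∀ n : ℕ, 0 ≤ Real.exp (-ν.real univ) / n.factorial := fun n => by positivity
  have hpow : ∀ q : ℂ, -b₀ < q.re → ∀ n : ℕ,
      Integrable (fun x : ℝ => Complex.exp (-(q * x))) (convPow ν n) ∧
      ∫ x : ℝ, Complex.exp (-(q * x)) ∂(convPow ν n) =
        (∫ x : ℝ, Complex.exp (-(q * x)) ∂ν) ^ n := fun q hq n =>
    integral_convPow (f := fun x : ℝ => Complex.exp (-(q * x))) (by fun_prop) (by simp)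
      (cexp_neg_mul_add q) (hint q hq) n
  have hI : ∀ q : ℂ, -b₀ < q.re →
      Integrable (fun x : ℝ => Complex.exp (-(q * x))) (compoundPoisson ν) := by
    intro q hq
    refine integrable_sum_measure
      (fun n => (hpow q hq n).1.smul_measure ENNReal.ofReal_ne_top) ?_
    have hreal := hint q hq |>.norm
    simp only [norm_cexp_neg_mul] at hreal
    have hr : ∀ n, ∫ x : ℝ, Real.exp (-(q.re * x)) ∂(convPow ν n) =
        (∫ x : ℝ, Real.exp (-(q.re * x)) ∂ν) ^ n := fun n =>
      (integral_convPow (f := fun x : ℝ => Real.exp (-(q.re * x))) (by fun_prop) (by simp)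
        (fun x y => by rw [← Real.exp_add]; ring_nf) hreal n).2
    simp only [integral_smul_measure, norm_cexp_neg_mul, hr,
      ENNReal.toReal_ofReal (hcoef _), smul_eq_mul]
    refine ((NormedSpace.expSeries_div_hasSum_exp
      (∫ x : ℝ, Real.exp (-(q.re * x)) ∂ν)).summable.mul_left
        (Real.exp (-ν.real univ))).congr fun n => ?_
    ring
  have hL : ∀ q : ℂ, -b₀ < q.re → ∫ x : ℝ, Complex.exp (-(q * x)) ∂(compoundPoisson ν) =
      Complex.exp (∫ x : ℝ, (Complex.exp (-(q * x)) - 1) ∂ν) := by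
    intro q hq
    have h1 := hasSum_integral_measure (hI q hq)
    simp only [integral_smul_measure, (hpow q hq _).2, ENNReal.toReal_ofReal (hcoef _)] at h1
    have h2 := (NormedSpace.expSeries_div_hasSum_exp
      (∫ x : ℝ, Complex.exp (-(q * x)) ∂ν)).mul_left (Complex.exp (-ν.real univ))
    rw [← Complex.exp_eq_exp_ℂ, ← Complex.exp_add] at h2
    rw [integral_sub (hint q hq) (integrable_const _), integral_const, Complex.real_smul, mul_one,
      sub_eq_neg_add]
    refine h1.unique (h2.congr_fun fun n => ?_)
    rw [Complex.real_smul]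
    push_cast
    ring
  refine ⟨?_, ?_, hI, hL⟩
  · have h0 : -b₀ < (0 : ℂ).re := by simpa using hb₀
    refine isProbabilityMeasure_of_laplace (hI 0 h0) ?_
    rw [hL 0 h0]
    simp
  · rw [compoundPoisson, Measure.sum_apply _ measurableSet_Iio]
    simp [convPow_Iio_zero hν]

/-! ### Measures with a density on `(0, ∞)` -/

/-- The measure on `(0, ∞)` with density `f`. -/
noncomputable def posDensity (f : ℝ → ℝ) : Measure ℝ :=
  (volume.restrict (Ioi 0)).withDensity fun t => ENNReal.ofReal (f t)

section PosDensity

variable {f : ℝ → ℝ}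

theorem posDensity_Iio_zero (f : ℝ → ℝ) : posDensity f (Iio 0) = 0 := by
  refine withDensity_absolutelyContinuous _ _ ?_
  rw [Measure.restrict_apply measurableSet_Iio]
  have : Iio (0 : ℝ) ∩ Ioi 0 = ∅ := by
    ext x
    simp only [mem_inter_iff, mem_Iio, mem_Ioi, mem_empty_iff_false, iff_false, not_and, not_lt]
    exact fun h => h.le
  rw [this, measure_empty]

theorem integrable_posDensity_iff (hf : ContinuousOn f (Ioi 0)) (hf0 : ∀ t, 0 < t → 0 ≤ f t)
    {g : ℝ → ℂ} : Integrable g (posDensity f) ↔ IntegrableOn (fun t => g t * (f t : ℂ)) (Ioi 0) := by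
  rw [posDensity, integrable_withDensity_iff_integrable_smul₀'
    (hf.aemeasurable measurableSet_Ioi).ennreal_ofReal (by simp), IntegrableOn]
  refine integrable_congr ((ae_restrict_iff' measurableSet_Ioi).2
    (Eventually.of_forall fun t ht => ?_))
  simp only
  rw [ENNReal.toReal_ofReal (hf0 t ht), Complex.real_smul, mul_comm]

theorem integral_posDensity (hf : ContinuousOn f (Ioi 0)) (hf0 : ∀ t, 0 < t → 0 ≤ f t)
    (g : ℝ → ℂ) : ∫ t, g t ∂(posDensity f) = ∫ t in Ioi (0 : ℝ), g t * (f t : ℂ) := by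
  rw [posDensity, integral_withDensity_eq_integral_toReal_smul₀
    (hf.aemeasurable measurableSet_Ioi).ennreal_ofReal (by simp)]
  refine setIntegral_congr_fun measurableSet_Ioi fun t ht => ?_
  rw [ENNReal.toReal_ofReal (hf0 t ht), Complex.real_smul, mul_comm]

theorem hasLaplace_compoundPoisson_posDensity (hf : ContinuousOn f (Ioi 0))
    (hf0 : ∀ t, 0 < t → 0 ≤ f t) (hint : IntegrableOn f (Ioi 0)) {b₀ : ℝ} (hb₀ : 0 < b₀)
    (hL : ∀ q : ℂ, -b₀ < q.re →
      IntegrableOn (fun t : ℝ => (Complex.exp (-(q * t)) - 1) * (f t : ℂ)) (Ioi 0)) :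
    HasLaplace (compoundPoisson (posDensity f)) b₀ fun q =>
      Complex.exp (∫ t in Ioi (0 : ℝ), (Complex.exp (-(q * t)) - 1) * (f t : ℂ)) := by
  have hint' : IntegrableOn (fun t => (f t : ℂ)) (Ioi 0) := hint.ofReal
  have hfin : IsFiniteMeasure (posDensity f) := by
    refine (integrable_const_iff_isFiniteMeasure (one_ne_zero (α := ℂ))).1 ?_
    rw [integrable_posDensity_iff hf hf0]
    simpa using hint'
  have h := hasLaplace_compoundPoisson (posDensity_Iio_zero f) hb₀ fun q hq => by
    rw [integrable_posDensity_iff hf hf0]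
    refine ((hL q hq).add hint').congr (Eventually.of_forall fun t => ?_)
    simp only [Pi.add_apply]
    ring
  simpa only [integral_posDensity hf hf0] using h

/-- The Laplace transform of the gamma distribution with shape `C` and rate `r`. -/
theorem exists_hasLaplace_gamma {C r b₀ : ℝ} (hC : 0 < C) (hb₀ : 0 < b₀) (hr : b₀ ≤ r) :
    ∃ μ, HasLaplace μ b₀ fun q =>
      Complex.exp (-(C * (Complex.log (q + r) - Complex.log r))) := by
  have hr0 : 0 < r := hb₀.trans_le hr
  set c : ℝ := r ^ C / Real.Gamma C with hc
  have hc0 : 0 < c := div_pos (Real.rpow_pos_of_pos hr0 _) (Real.Gamma_pos_of_pos hC)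
  set g : ℝ → ℝ := fun t => c * (Real.exp (-(r * t)) * t ^ (C - 1)) with hg
  have hgc : ContinuousOn g (Ioi 0) := by
    refine continuousOn_const.mul (ContinuousOn.mul (by fun_prop) fun t ht => ?_)
    exact (Real.continuousAt_rpow_const t _ (Or.inl (ne_of_gt ht))).continuousWithinAt
  have hg0 : ∀ t, 0 < t → 0 ≤ g t := fun t ht => by positivity
  have hcast : ∀ (q : ℂ) (t : ℝ), Complex.exp (-(q * t)) * (g t : ℂ) =
      c * (Complex.exp (-((q + r) * t)) * ((t ^ (C - 1) : ℝ) : ℂ)) := by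
    intro q t
    rw [add_mul, neg_add, Complex.exp_add, hg]
    push_cast
    ring
  have hre : ∀ q : ℂ, -b₀ < q.re → 0 < (q + r).re := fun q hq => by
    rw [Complex.add_re, Complex.ofReal_re]; linarith
  have hI : ∀ q : ℂ, -b₀ < q.re →
      Integrable (fun x : ℝ => Complex.exp (-(q * x))) (posDensity g) := by
    intro q hq
    rw [integrable_posDensity_iff hgc hg0]
    simp only [hcast]
    exact (((IsSubexp.rpow (C - 1)).exp_mul (hre q hq)).integrableOn (by linarith)).const_mul _
  have hL : ∀ q : ℂ, -b₀ < q.re → ∫ x : ℝ, Complex.exp (-(q * x)) ∂(posDensity g) =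
      Complex.exp (-(C * (Complex.log (q + r) - Complex.log r))) := by
    intro q hq
    have hne : q + (r : ℂ) ≠ 0 := fun h => by
      have := hre q hq
      simp [h] at this
    have hrne : (r : ℂ) ≠ 0 := Complex.ofReal_ne_zero.2 hr0.ne'
    -- The gamma density integrates as a Mellin transform at s = 1 with exponent C - 1, giving Γ(1 +
    -- (C - 1)) = Γ(C), which the constant c cancels.
    have hm := mellin_exp_mul_rpow (s := 1) (hre q hq) (r := C - 1) (by simpa using hC)
    simp only [mellin, sub_self, Complex.cpow_zero, one_smul] at hm
    rw [integral_posDensity hgc hg0]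
    simp only [hcast]
    rw [integral_const_mul, hm, hc]
    push_cast
    rw [show (1 : ℂ) + (C - 1) = C by ring, Complex.ofReal_cpow hr0.le,
      Complex.cpow_def_of_ne_zero hne, Complex.cpow_def_of_ne_zero hrne]
    have hG : Complex.Gamma C ≠ 0 := Complex.Gamma_ne_zero_of_re_pos (by simpa using hC)
    rw [div_mul_eq_mul_div, ← mul_assoc, mul_right_comm, mul_div_assoc,
      ← Complex.Gamma_ofReal, div_self hG, mul_one, ← Complex.exp_add]
    congr 1
    ring
  refine ⟨posDensity g, ?_, posDensity_Iio_zero g, hI, hL⟩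
  have h0 : -b₀ < (0 : ℂ).re := by simpa using hb₀
  refine isProbabilityMeasure_of_laplace (hI 0 h0) ?_
  rw [hL 0 h0]
  simp

end PosDensity

/-! ### The Barnes beta distribution -/

section Beta

variable {M N : ℕ} {a : Fin M → ℝ} {b₀ : ℝ} {b : Fin N → ℝ}

/-- With β = exp(-X), the moment E[β^q] is the Laplace transform of X at q, and X ≥ 0 puts β in (0,
1]. -/
theorem HasLaplace.isBarnesBeta {μ : Measure ℝ} (h : HasLaplace μ b₀ (barnesEta a b₀ b)) :
    IsBarnesBeta a b₀ b (μ.map fun x => Real.exp (-x)) := by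
  have := h.1
  have hm : Measurable fun x : ℝ => Real.exp (-x) := by fun_prop
  have hpow : ∀ (q : ℂ) (x : ℝ), ((Real.exp (-x) : ℝ) : ℂ) ^ q = Complex.exp (-(q * x)) := by
    intro q x
    rw [Complex.cpow_def_of_ne_zero (Complex.ofReal_ne_zero.2 (Real.exp_ne_zero _)),
      ← Complex.ofReal_log (Real.exp_nonneg _), Real.log_exp]
    push_cast
    ring_nf
  have hmeas : ∀ q : ℂ, AEStronglyMeasurable (fun x : ℝ => (x : ℂ) ^ q)
      (μ.map fun x => Real.exp (-x)) := fun q =>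
    (Complex.measurable_ofReal.pow_const q).aestronglyMeasurable
  refine ⟨Measure.isProbabilityMeasure_map hm.aemeasurable, ?_, fun q hq => ?_, fun q hq => ?_⟩
  · rw [Measure.map_apply hm measurableSet_Ioc.compl]
    refine measure_mono_null (fun x hx => ?_) h.2
    by_contra hc
    exact hx ⟨Real.exp_pos _, Real.exp_le_one_iff.2 (by simpa using hc)⟩
  · rw [integrable_map_measure (hmeas q) hm.aemeasurable]
    simpa only [Function.comp_def, hpow] using h.3 q hq
  · rw [integral_map hm.aemeasurable (hmeas q)]
    simpa only [hpow] using h.4 q hq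

theorem exists_hasLaplace_barnesEta_of_lt (ha : ∀ i, 0 < a i) (hb₀ : 0 < b₀) (hb : ∀ j, 0 < b j)
    (hMN : M < N) : ∃ μ, HasLaplace μ b₀ (barnesEta a b₀ b) := by
  have h0 := (opS_barnesLogGamma_eq_integral ha hb hMN (q := 0) (b₀ := b₀) (by simpa using hb₀)).1
  simp only [zero_mul, neg_zero, Complex.exp_zero, one_mul] at h0
  have hint : IntegrableOn (levyDensity a b₀ b) (Ioi 0) := by
    simpa [IntegrableOn] using h0.re
  have h := hasLaplace_compoundPoisson_posDensity (continuousOn_levyDensity ha)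
    (fun t ht => (levyDensity_pos ha hb ht).le) hint hb₀
    (fun q hq => (opS_barnesLogGamma_sub_eq_integral ha hb₀ hb hMN.le hq).1)
  refine ⟨_, h.1, h.2, h.3, fun q hq => ?_⟩
  rw [h.4 q hq, barnesEta, (opS_barnesLogGamma_sub_eq_integral ha hb₀ hb hMN.le hq).2]

end Beta

/-! ### Frullani's integral as the case M = N = 0 -/

theorem levyDensity_fin_zero (a b : Fin 0 → ℝ) (r t : ℝ) :
    levyDensity a r b t = t⁻¹ * Real.exp (-(r * t)) := by
  simp [levyDensity, barnesK]

theorem opS_fin_zero (h : ℂ → ℂ) (q : ℂ) (r : ℝ) (b : Fin 0 → ℝ) :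
    opS h q r b = h (q + r) := by
  simp [opS]

/-- Frullani's integral. -/
theorem integral_frullani {r : ℝ} (hr : 0 < r) {q : ℂ} (hq : -r < q.re) :
    IntegrableOn (fun t : ℝ => (Complex.exp (-(q * t)) - 1) *
      ((t⁻¹ * Real.exp (-(r * t)) : ℝ) : ℂ)) (Ioi 0) ∧
    ∫ t in Ioi (0 : ℝ), (Complex.exp (-(q * t)) - 1) * ((t⁻¹ * Real.exp (-(r * t)) : ℝ) : ℂ) =
      -(Complex.log (q + r) - Complex.log r) := by
  have h := opS_barnesLogGamma_sub_eq_integral (a := (Fin.elim0 : Fin 0 → ℝ))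
    (b := (Fin.elim0 : Fin 0 → ℝ)) (fun i => i.elim0) hr (fun j => j.elim0) le_rfl hq
  simp only [levyDensity_fin_zero] at h
  refine ⟨h.1, ?_⟩
  rw [← h.2, opS_fin_zero, opS_fin_zero, zero_add, barnesLogGamma_fin_zero, barnesLogGamma_fin_zero]
  · ring
  · exact Or.inl (by simpa using hr)
  · refine Or.inl ?_
    rw [Complex.add_re, Complex.ofReal_re]
    linarith

/-! ### The case M = N: splitting off a gamma law -/

section Diagonal

variable {N : ℕ} {a : Fin N → ℝ} {b₀ : ℝ} {b : Fin N → ℝ}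

/-- From 1 + x ≤ exp x come x exp(-x) ≤ 1 - exp(-x), used for each b_j t, and 1 - exp(-x) ≤ x, used
for each a_i t. The powers of t cancel because there are equally many of both. -/
theorem le_prod_mul_barnesK (ha : ∀ i, 0 < a i) (hb : ∀ j, 0 < b j) {t : ℝ} (ht : 0 < t) :
    (∏ j, b j) * (∏ i, (a i)⁻¹) * Real.exp (-((∑ j, b j) * t)) ≤
      (∏ j, (1 - Real.exp (-(b j * t)))) * barnesK a t := by
  have h1 : ∀ j, b j * t * Real.exp (-(b j * t)) ≤ 1 - Real.exp (-(b j * t)) := by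
    intro j
    have h := Real.add_one_le_exp (b j * t)
    have h2 : Real.exp (b j * t) * Real.exp (-(b j * t)) = 1 := by
      rw [← Real.exp_add, add_neg_cancel, Real.exp_zero]
    nlinarith [Real.exp_pos (-(b j * t))]
  have h2 : ∀ i, (a i * t)⁻¹ ≤ (1 - Real.exp (-(a i * t)))⁻¹ := by
    intro i
    refine inv_anti₀ (one_sub_exp_pos (ha i) ht) ?_
    linarith [Real.one_sub_le_exp_neg (a i * t)]
  have e : (∏ j, b j) * (∏ i, (a i)⁻¹) * Real.exp (-((∑ j, b j) * t)) =
      (∏ j, b j * t * Real.exp (-(b j * t))) * ∏ i, (a i * t)⁻¹ := by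
    rw [Finset.sum_mul, ← Finset.sum_neg_distrib, Real.exp_sum]
    simp only [← Finset.prod_mul_distrib]
    refine Finset.prod_congr rfl fun j _ => ?_
    rw [mul_inv]
    field_simp
  rw [e]
  refine mul_le_mul (Finset.prod_le_prod (fun j _ => ?_) fun j _ => h1 j)
    (Finset.prod_le_prod (fun i _ => ?_) fun i _ => h2 i) (Finset.prod_nonneg fun i _ => ?_)
    (Finset.prod_nonneg fun j _ => (one_sub_exp_pos (hb j) ht).le)
  · have := hb j; positivity
  all_goals have := ha i; positivity

/-- The constant C is the value of `barnesRatio` at 0, so subtracting C exp(-σt) leaves a function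
of size O(t). Division by t is then harmless at 0, and exp(-b₀ t) gives decay at infinity. -/
theorem integrableOn_levyDensity_sub (ha : ∀ i, 0 < a i) (hb₀ : 0 < b₀) (hb : ∀ j, 0 < b j) :
    IntegrableOn (fun t => levyDensity a b₀ b t - (∏ j, b j) * (∏ i, (a i)⁻¹) *
      (t⁻¹ * Real.exp (-((b₀ + ∑ j, b j) * t)))) (Ioi 0) := by
  set C := (∏ j, b j) * (∏ i, (a i)⁻¹) with hC
  set σ := ∑ j, b j with hσ
  have hσ0 : 0 ≤ σ := Finset.sum_nonneg fun j _ => (hb j).le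
  set φ : ℝ → ℝ := fun t =>
    (∏ j, (1 - Real.exp (-(b j * t)))) * barnesK a t - C * Real.exp (-(σ * t)) with hφ
  have hone : ∀ {ε : ℝ}, 0 < ε → (fun _ : ℝ => (1 : ℝ)) =O[atTop] fun t : ℝ => Real.exp (ε * t) := by
    intro ε hε
    refine IsBigO.of_bound 1 ?_
    filter_upwards [eventually_ge_atTop 0] with t ht
    rw [norm_one, one_mul, Real.norm_of_nonneg (Real.exp_nonneg _)]
    exact Real.one_le_exp (by positivity)
  have hsub : IsSubexp (fun t => (φ t : ℂ)) (-1) := by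
    refine ⟨?_, ?_, fun ε hε => ?_⟩
    · refine Complex.continuous_ofReal.comp_continuousOn (ContinuousOn.sub ?_ (by fun_prop))
      exact ContinuousOn.mul (by fun_prop) (continuousOn_barnesK ha)
    · have hd : DifferentiableAt ℝ (fun t => barnesRatio a b t - C * Real.exp (-(σ * t))) 0 :=
        (analyticAt_barnesRatio ha).differentiableAt.fun_sub (by fun_prop)
      have hzero : barnesRatio a b 0 - C * Real.exp (-(σ * 0)) = 0 := by
        simp [barnesRatio, expQuot_zero, hC]
      have h := hd.isBigO_sub.mono (nhdsWithin_le_nhds (s := Ioi 0))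
      simp only [hzero, sub_zero] at h
      refine IsBigO.of_norm_left (h.norm_left.congr' ?_ (Eventually.of_forall fun t => by simp))
      filter_upwards [self_mem_nhdsWithin] with t ht
      rw [Complex.norm_real, hφ]
      simp only
      rw [prod_mul_barnesK_eq ht, sub_self, Real.rpow_zero, mul_one]
    · have h1 : (fun t : ℝ => ((∏ j, (1 - Real.exp (-(b j * t))) : ℝ) : ℂ)) =O[atTop]
          fun _ : ℝ => (1 : ℝ) := by
        refine IsBigO.of_bound 1 ?_
        filter_upwards [eventually_gt_atTop 0] with t ht
        rw [Complex.norm_real, norm_one, mul_one, Real.norm_of_nonneg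
          (Finset.prod_nonneg fun j _ => (one_sub_exp_pos (hb j) ht).le)]
        exact Finset.prod_le_one (fun j _ => (one_sub_exp_pos (hb j) ht).le)
          fun j _ => by linarith [Real.exp_pos (-(b j * t))]
      have h2 : (fun t : ℝ => ((Real.exp (-(σ * t)) : ℝ) : ℂ)) =O[atTop]
          fun _ : ℝ => (1 : ℝ) := by
        refine IsBigO.of_bound 1 ?_
        filter_upwards [eventually_ge_atTop 0] with t ht
        rw [Complex.norm_real, norm_one, mul_one, Real.norm_of_nonneg (Real.exp_nonneg _),
          Real.exp_le_one_iff]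
        exact neg_nonpos.2 (mul_nonneg hσ0 ht)
      have h3 := ((h1.mul (barnesK_isBigO_exp ha hε)).congr_right fun t => one_mul _).sub
        ((h2.const_mul_left (C : ℂ)).trans (hone hε))
      refine h3.congr_left fun t => ?_
      simp [hφ]
  have h := (((hsub.mul_rpow (-1)).exp_mul (w := (b₀ : ℂ)) (by simpa using hb₀)).integrableOn
    (by norm_num)).re
  refine IntegrableOn.congr_fun h (fun t ht => ?_) measurableSet_Ioi
  have e : Complex.exp (-((b₀ : ℂ) * t)) * ((φ t : ℂ) * ((t ^ (-1 : ℝ) : ℝ) : ℂ)) =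
      ((Real.exp (-(b₀ * t)) * (φ t * t⁻¹) : ℝ) : ℂ) := by
    rw [Real.rpow_neg_one]
    push_cast
    ring
  simp only [e]
  rw [RCLike.re_to_complex, Complex.ofReal_re, hφ, levyDensity, add_mul, neg_add, Real.exp_add]
  ring

theorem exists_hasLaplace_barnesEta_diagonal (ha : ∀ i, 0 < a i) (hb₀ : 0 < b₀)
    (hb : ∀ j, 0 < b j) : ∃ μ, HasLaplace μ b₀ (barnesEta a b₀ b) := by
  set C := (∏ j, b j) * (∏ i, (a i)⁻¹) with hC
  -- This rate makes the remainder f nonnegative, by the lower bound `le_prod_mul_barnesK`, and r ≥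
  -- b₀ keeps the gamma transform finite for Re q > -b₀.
  set r := b₀ + ∑ j, b j with hr
  have hC0 : 0 < C := mul_pos (Finset.prod_pos fun j _ => hb j)
    (Finset.prod_pos fun i _ => inv_pos.2 (ha i))
  have hbr : b₀ ≤ r := le_add_of_nonneg_right (Finset.sum_nonneg fun j _ => (hb j).le)
  have hr0 : 0 < r := hb₀.trans_le hbr
  set f : ℝ → ℝ := fun t => levyDensity a b₀ b t - C * (t⁻¹ * Real.exp (-(r * t))) with hf
  have hfc : ContinuousOn f (Ioi 0) :=
    (continuousOn_levyDensity ha).sub (continuousOn_const.mul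
      ((continuousOn_id.inv₀ fun _ ht => ne_of_gt ht).mul (by fun_prop)))
  have hf0 : ∀ t, 0 < t → 0 ≤ f t := by
    intro t ht
    have h := le_prod_mul_barnesK ha hb ht
    have e : f t = t⁻¹ * (Real.exp (-(b₀ * t)) * ((∏ j, (1 - Real.exp (-(b j * t)))) *
        barnesK a t - C * Real.exp (-((∑ j, b j) * t)))) := by
      rw [hf]
      simp only
      rw [levyDensity, hr, add_mul, neg_add, Real.exp_add]
      ring
    rw [e]
    exact mul_nonneg (inv_nonneg.2 ht.le) (mul_nonneg (Real.exp_nonneg _) (sub_nonneg.2 h))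
  have hsplit : ∀ (q : ℂ) (t : ℝ), (Complex.exp (-(q * t)) - 1) * (f t : ℂ) =
      (Complex.exp (-(q * t)) - 1) * (levyDensity a b₀ b t : ℂ) - C *
        ((Complex.exp (-(q * t)) - 1) * ((t⁻¹ * Real.exp (-(r * t)) : ℝ) : ℂ)) := by
    intro q t
    rw [hf]
    push_cast
    ring
  have hS := fun q : ℂ => fun hq : -b₀ < q.re =>
    opS_barnesLogGamma_sub_eq_integral ha hb₀ hb le_rfl hq
  have hF := fun q : ℂ => fun hq : -b₀ < q.re =>
    integral_frullani hr0 (q := q) (by linarith)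
  have hP := hasLaplace_compoundPoisson_posDensity hfc hf0 (integrableOn_levyDensity_sub ha hb₀ hb)
    hb₀ fun q hq => by
      simp only [hsplit]
      exact (hS q hq).1.sub ((hF q hq).1.const_mul _)
  obtain ⟨γ, hγ⟩ := exists_hasLaplace_gamma hC0 hb₀ hbr
  -- By Frullani's integral the gamma factor contributes C ∫ (exp(-qt) - 1) exp(-rt) dt/t to the
  -- exponent, the part removed from ν.
  have h := hP.conv hγ
  refine ⟨_, h.1, h.2, h.3, fun q hq => ?_⟩
  rw [h.4 q hq, ← Complex.exp_add, barnesEta]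
  simp only [hsplit]
  rw [integral_sub (hS q hq).1 ((hF q hq).1.const_mul _), integral_const_mul, (hF q hq).2,
    ← (hS q hq).2]
  congr 1
  ring

end Diagonal

/-! ### Existence, uniqueness, moments and the mass at 1 -/

section Main

variable {M N : ℕ} {b₀ : ℝ} {b : Fin N → ℝ}

theorem exists_isBarnesBeta {a : Fin M → ℝ} (ha : ∀ i, 0 < a i) (hb₀ : 0 < b₀)
    (hb : ∀ j, 0 < b j) (hMN : M ≤ N) : ∃ μ, IsBarnesBeta a b₀ b μ := by
  rcases hMN.lt_or_eq with h | rfl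
  · obtain ⟨μ, hμ⟩ := exists_hasLaplace_barnesEta_of_lt ha hb₀ hb h
    exact ⟨_, hμ.isBarnesBeta⟩
  · obtain ⟨μ, hμ⟩ := exists_hasLaplace_barnesEta_diagonal ha hb₀ hb
    exact ⟨_, hμ.isBarnesBeta⟩

theorem IsBarnesBeta.ae_mem {a : Fin M → ℝ} {μ : Measure ℝ} (h : IsBarnesBeta a b₀ b μ) :
    ∀ᵐ x ∂μ, x ∈ Ioc (0 : ℝ) 1 := h.support

/-- On the imaginary axis, which lies in Re q > -b₀, the Mellin transform is the characteristic
function of log β. It determines the law of log β, hence that of β = exp(log β). -/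
theorem IsBarnesBeta.unique {a : Fin M → ℝ} {μ ν : Measure ℝ} (hb₀ : 0 < b₀)
    (hμ : IsBarnesBeta a b₀ b μ) (hν : IsBarnesBeta a b₀ b ν) : μ = ν := by
  have key : ∀ {μ : Measure ℝ}, IsBarnesBeta a b₀ b μ →
      (μ.map Real.log).map Real.exp = μ ∧
      ∀ t : ℝ, charFun (μ.map Real.log) t = barnesEta a b₀ b (t * Complex.I) := by
    intro μ h
    refine ⟨?_, fun t => ?_⟩
    · rw [Measure.map_map Real.measurable_exp Real.measurable_log]
      conv_rhs => rw [← Measure.map_id (μ := μ)]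
      refine Measure.map_congr ?_
      filter_upwards [h.ae_mem] with x hx using Real.exp_log hx.1
    · rw [charFun_apply_real, integral_map Real.measurable_log.aemeasurable
        (Continuous.aestronglyMeasurable (by fun_prop)), ← h.mellin _ (by simpa using hb₀)]
      refine integral_congr_ae ?_
      filter_upwards [h.ae_mem] with x hx
      rw [Complex.cpow_def_of_ne_zero (Complex.ofReal_ne_zero.2 hx.1.ne'),
        ← Complex.ofReal_log hx.1.le]
      ring_nf
  have := hμ.1
  have := hν.1
  have := Measure.isProbabilityMeasure_map (μ := μ) Real.measurable_log.aemeasurable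
  have := Measure.isProbabilityMeasure_map (μ := ν) Real.measurable_log.aemeasurable
  rw [← (key hμ).1, ← (key hν).1, Measure.ext_of_charFun
    (funext fun t => ((key hμ).2 t).trans ((key hν).2 t).symm)]

/-- The real Mellin transform of the Barnes beta distribution. -/
theorem IsBarnesBeta.ofReal_integral_rpow {a : Fin M → ℝ} {μ : Measure ℝ}
    (h : IsBarnesBeta a b₀ b μ) {r : ℝ} (hr : -b₀ < r) :
    ((∫ x : ℝ, x ^ r ∂μ : ℝ) : ℂ) = barnesEta a b₀ b r := by
  rw [← h.mellin r (by simpa using hr), ← integral_complex_ofReal]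
  refine integral_congr_ae ?_
  filter_upwards [h.ae_mem] with x hx
  exact Complex.ofReal_cpow hx.1.le r

/-- The difference equation telescopes along the multiples of a_M; each step contributes a term with
one parameter fewer, to which the product formula applies. -/
theorem opS_barnesLogGamma_add_nat_mul {a : Fin (M + 1) → ℝ} (ha : ∀ i, 0 < a i) (hb₀ : 0 < b₀)
    (hb : ∀ j, 0 < b j) (k : ℕ) :
    opS (barnesLogGamma a) ((k * a (Fin.last M) : ℝ) : ℂ) b₀ b - opS (barnesLogGamma a) 0 b₀ b =
      ∑ l ∈ Finset.range k,
        -opS (barnesLogGamma (fun i : Fin M => a i.castSucc)) ((l * a (Fin.last M) : ℝ) : ℂ) b₀ b := by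
  induction k with
  | zero => simp
  | succ k ih =>
    have hα : 0 < a (Fin.last M) := ha _
    have hq : ((k * a (Fin.last M) : ℝ) : ℂ) + (b₀ : ℂ) ∈ Complex.slitPlane := by
      refine Or.inl ?_
      rw [← Complex.ofReal_add, Complex.ofReal_re]
      positivity
    have h := opS_barnesLogGamma_succ ha hb hq
    have e : ((k * a (Fin.last M) : ℝ) : ℂ) + (a (Fin.last M) : ℂ) =
        (((k + 1 : ℕ) * a (Fin.last M) : ℝ) : ℂ) := by push_cast; ring
    rw [e] at h
    rw [Finset.sum_range_succ, ← ih, h]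
    ring

theorem IsBarnesBeta.integral_rpow_nat_mul {a : Fin (M + 1) → ℝ} (ha : ∀ i, 0 < a i)
    (hb₀ : 0 < b₀) (hb : ∀ j, 0 < b j) (hMN : M < N) {μ : Measure ℝ}
    (hμ : IsBarnesBeta a b₀ b μ) (k : ℕ) :
    (∀ l : ℕ, Multipliable fun n : Fin M → ℕ => altProd ((l : ℝ) * a (Fin.last M) + b₀ +
      latticeSum (fun i : Fin M => a i.castSucc) n) b) ∧
    ∫ x : ℝ, x ^ ((k : ℝ) * a (Fin.last M)) ∂μ =
      ∏ l ∈ Finset.range k, ∏' n : Fin M → ℕ, altProd ((l : ℝ) * a (Fin.last M) + b₀ +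
        latticeSum (fun i : Fin M => a i.castSucc) n) b := by
  have hα : 0 < a (Fin.last M) := ha _
  have h := fun l : ℕ => hasProd_altProd_real (a := fun i : Fin M => a i.castSucc) (b := b)
    (fun i => ha _) hb₀ hb hMN (x := l * a (Fin.last M)) (by positivity)
  choose p hp hpe using h
  refine ⟨fun l => (hp l).multipliable, ?_⟩
  have hk : -b₀ < (k : ℝ) * a (Fin.last M) := by
    have : 0 ≤ (k : ℝ) * a (Fin.last M) := by positivity
    linarith
  apply Complex.ofReal_injective
  rw [hμ.ofReal_integral_rpow hk, barnesEta, opS_barnesLogGamma_add_nat_mul ha hb₀ hb,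
    Complex.exp_sum, Complex.ofReal_prod]
  exact Finset.prod_congr rfl fun l _ => by rw [(hp l).tprod_eq, hpe]

/-- A Laplace transform vanishes at infinity by dominated convergence; the Lévy density itself
dominates, being integrable for M < N. -/
theorem tendsto_opS_barnesLogGamma_nat {a : Fin M → ℝ} (ha : ∀ i, 0 < a i) (hb₀ : 0 < b₀)
    (hb : ∀ j, 0 < b j) (hMN : M < N) :
    Tendsto (fun n : ℕ => opS (barnesLogGamma a) (n : ℂ) b₀ b) atTop (𝓝 0) := by
  have hq : ∀ n : ℕ, -b₀ < ((n : ℂ)).re := fun n => by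
    rw [Complex.natCast_re]
    linarith [(Nat.cast_nonneg n : (0 : ℝ) ≤ n)]
  have hrep := fun n : ℕ => opS_barnesLogGamma_eq_integral ha hb hMN (hq n)
  simp only [(hrep _).2]
  rw [← integral_zero (α := ℝ) ℂ (μ := volume.restrict (Ioi 0))]
  refine tendsto_integral_of_dominated_convergence (levyDensity a b₀ b)
    (fun n => (hrep n).1.aestronglyMeasurable) ?_ (fun n => ?_) ?_
  · have h := (hrep 0).1.re
    simpa using h
  · refine (ae_restrict_iff' measurableSet_Ioi).2 (Eventually.of_forall fun t ht => ?_)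
    have ht' : 0 < t := ht
    rw [norm_mul, norm_cexp_neg_mul, Complex.norm_real,
      Real.norm_of_nonneg (levyDensity_pos ha hb ht').le, Complex.natCast_re]
    refine mul_le_of_le_one_left (levyDensity_pos ha hb ht').le (Real.exp_le_one_iff.2 ?_)
    exact neg_nonpos.2 (by positivity)
  · refine (ae_restrict_iff' measurableSet_Ioi).2 (Eventually.of_forall fun t ht => ?_)
    have hr : Tendsto (fun n : ℕ => Real.exp (-((n : ℝ) * t))) atTop (𝓝 0) :=
      Real.tendsto_exp_neg_atTop_nhds_zero.comp
        (tendsto_natCast_atTop_atTop.atTop_mul_const ht)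
    have hc : Tendsto (fun n : ℕ => Complex.exp (-((n : ℂ) * t))) atTop (𝓝 0) := by
      rw [tendsto_zero_iff_norm_tendsto_zero]
      simpa only [norm_cexp_neg_mul, Complex.natCast_re] using hr
    simpa using hc.mul_const (levyDensity a b₀ b t : ℂ)

/-- On (0, 1] the powers x^n converge boundedly to the indicator of {1}. -/
theorem IsBarnesBeta.tendsto_integral_pow {a : Fin M → ℝ} {μ : Measure ℝ}
    (h : IsBarnesBeta a b₀ b μ) :
    Tendsto (fun n : ℕ => ∫ x : ℝ, x ^ (n : ℝ) ∂μ) atTop (𝓝 (μ.real {1})) := by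
  have := h.1
  rw [← integral_indicator_one (measurableSet_singleton (1 : ℝ))]
  refine tendsto_integral_of_dominated_convergence (fun _ => 1) (fun n => ?_)
    (integrable_const 1) (fun n => ?_) ?_
  · exact (measurable_id.pow_const (n : ℝ)).aestronglyMeasurable
  · filter_upwards [h.ae_mem] with x hx
    rw [Real.rpow_natCast, norm_pow, Real.norm_of_nonneg hx.1.le]
    exact pow_le_one₀ hx.1.le hx.2
  · filter_upwards [h.ae_mem] with x hx
    simp only [Real.rpow_natCast]
    rcases hx.2.lt_or_eq with h1 | rfl
    · rw [indicator_of_notMem (by simpa using h1.ne)]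
      exact tendsto_pow_atTop_nhds_zero_of_lt_one hx.1.le h1
    · simp

/-- The limit of the integer moments is computed twice: as the mass at 1, and as exp(-(𝒮_N L_M)(0)),
which is the product formula at q = 0. -/
theorem IsBarnesBeta.hasProd_real_singleton_one {a : Fin M → ℝ} (ha : ∀ i, 0 < a i) (hb₀ : 0 < b₀)
    (hb : ∀ j, 0 < b j) (hMN : M < N) {μ : Measure ℝ} (hμ : IsBarnesBeta a b₀ b μ) :
    HasProd (fun n : Fin M → ℕ => altProd (b₀ + latticeSum a n) b) (μ.real {1}) := by
  obtain ⟨p, hp, hpe⟩ := hasProd_altProd_real ha hb₀ hb hMN le_rfl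
  simp only [zero_add] at hp
  have h1 : Tendsto (fun n : ℕ => ((∫ x : ℝ, x ^ (n : ℝ) ∂μ : ℝ) : ℂ)) atTop
      (𝓝 ((μ.real {1} : ℝ) : ℂ)) :=
    (Complex.continuous_ofReal.tendsto _).comp hμ.tendsto_integral_pow
  have h2 : Tendsto (fun n : ℕ => ((∫ x : ℝ, x ^ (n : ℝ) ∂μ : ℝ) : ℂ)) atTop (𝓝 (p : ℂ)) := by
    have he : ∀ n : ℕ, ((∫ x : ℝ, x ^ (n : ℝ) ∂μ : ℝ) : ℂ) = Complex.exp
        (opS (barnesLogGamma a) (n : ℂ) b₀ b - opS (barnesLogGamma a) 0 b₀ b) := fun n => by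
      rw [hμ.ofReal_integral_rpow (by linarith [(Nat.cast_nonneg n : (0 : ℝ) ≤ n)]), barnesEta,
        Complex.ofReal_natCast]
    simp only [he]
    rw [hpe, ← zero_sub, Complex.ofReal_zero]
    exact ((tendsto_opS_barnesLogGamma_nat ha hb₀ hb hMN).sub_const _).cexp
  rw [Complex.ofReal_injective (tendsto_nhds_unique h1 h2)]
  exact hp

end Main

end BarnesBeta

theorem mainTheorem4 {N : ℕ} (b₀ : ℝ) (hb₀ : 0 < b₀) (b : Fin N → ℝ) (hb : ∀ j, 0 < b j) :
    -- the action of `𝒮_N` on `L_M`, for `M < N` and `q ∈ ℂ \ (-∞, -b₀]`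
    (∀ (M : ℕ) (a : Fin M → ℝ), (∀ i, 0 < a i) → M < N →
      ∀ q : ℂ, q + (b₀ : ℂ) ∈ Complex.slitPlane →
        HasProd
          (fun n : Fin M → ℕ =>
            BarnesBeta.altProd (q + (b₀ : ℂ) + (BarnesBeta.latticeSum a n : ℂ))
              (fun j => (b j : ℂ)))
          (Complex.exp (-BarnesBeta.opS (BarnesBeta.barnesLogGamma a) q b₀ b))) ∧
    -- the distribution `β_{M,N}(a, b)` is well defined for `M ≤ N`
    (∀ (M : ℕ) (a : Fin M → ℝ), (∀ i, 0 < a i) → M ≤ N →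
      ∃! μ : MeasureTheory.Measure ℝ, BarnesBeta.IsBarnesBeta a b₀ b μ) ∧
    -- the moments of order `k a_M` (`M + 1` is written for the `M ≥ 1` of the usual notation)
    (∀ (M : ℕ) (a : Fin (M + 1) → ℝ), (∀ i, 0 < a i) → M + 1 ≤ N →
      ∀ μ : MeasureTheory.Measure ℝ, BarnesBeta.IsBarnesBeta a b₀ b μ → ∀ k : ℕ,
        (∀ l ∈ Finset.range k, Multipliable (fun n : Fin M → ℕ =>
          BarnesBeta.altProd ((l : ℝ) * a (Fin.last M) + b₀ +
            BarnesBeta.latticeSum (fun i : Fin M => a i.castSucc) n) b)) ∧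
        ∫ x : ℝ, x ^ ((k : ℝ) * a (Fin.last M)) ∂μ =
          ∏ l ∈ Finset.range k, ∏' n : Fin M → ℕ,
            BarnesBeta.altProd ((l : ℝ) * a (Fin.last M) + b₀ +
              BarnesBeta.latticeSum (fun i : Fin M => a i.castSucc) n) b) ∧
    -- the mass at `1`, for `M < N`
    (∀ (M : ℕ) (a : Fin M → ℝ), (∀ i, 0 < a i) → M < N →
      ∀ μ : MeasureTheory.Measure ℝ, BarnesBeta.IsBarnesBeta a b₀ b μ →
        HasProd
          (fun n : Fin M → ℕ => BarnesBeta.altProd (b₀ + BarnesBeta.latticeSum a n) b)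
          (μ.real {1})) := by
  refine ⟨fun M a ha hMN q hq => BarnesBeta.hasProd_altProd ha hb hMN hq,
    fun M a ha hMN => ?_, fun M a ha hMN μ hμ k => ?_,
    fun M a ha hMN μ hμ => hμ.hasProd_real_singleton_one ha hb₀ hb hMN⟩
  · obtain ⟨μ, hμ⟩ := BarnesBeta.exists_isBarnesBeta ha hb₀ hb hMN
    exact ⟨μ, hμ, fun ν hν => hν.unique hb₀ hμ⟩
  · have h := hμ.integral_rpow_nat_mul ha hb₀ hb hMN k
    exact ⟨fun l _ => h.1 l, h.2⟩
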